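/- For a real random variable $U$ let $\|U\|_{\psi_2}=\inf\{t>0:\mathbb{E}\exp(U^2/t^2)\le 2\}$, and for a nonzero positive semi-definite matrix $\Sigma$ let $\mathrm{r_e}(\Sigma)=\mathrm{tr}(\Sigma)/\|\Sigma\|$, with $\|\cdot\|$ the operator norm, be its effective rank. Let $(X,y)\in\mathbb{R}^p\times\mathbb{R}$ be a random pair, let $\Sigma_X$ be the covariance matrix of $X$, and let $\sigma_y^2=\mathbb{E}[y^2]>0$. Suppose that $X=\Sigma_X^{1/2}\tilde X$ and $y=\sigma_y\tilde y$, where $\tilde X$ has independent entries, and the entries of $\tilde X$ as well as $\tilde y$ have zero mean, unit variance and $\psi_2$-norm at most $M$ (the dependence between $\tilde X$ and $\tilde y$ is arbitrary). Let $(X_1,y_1),\dots,(X_n,y_n)$ be i.i.d. copies of $(X,y)$, let $\mathbf{X}\in\mathbb{R}^{n\times p}$ be the matrix with rows $X_1,\dots,X_n$, let $\mathbf{y}=(y_1,\dots,y_n)^\top$, and let $$\widehat\alpha=\arg\min\{\|\alpha\|:\ \|\mathbf{X}\alpha-\mathbf{y}\|=\min_{u\in\mathbb{R}^p}\|\mathbf{X}u-\mathbf{y}\|\}$$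 be the minimum-norm least-squares estimator. For $\alpha\in\mathbb{R}^p$ let $R(\alpha)=\mathbb{E}[(X^\top\alpha-y)^2]$, where the expectation is over the pair $(X,y)$ only, so that $R(\widehat\alpha)$ is a function of the sample. (i) For every $M>0$ there are constants $C>1$ and $c,c',K>0$, depending only on $M$, such that for all $n$, all $p$ and all distributions of $(X,y)$ as above with $\mathrm{r_e}(\Sigma_X)>C\,n$, with probability at least $1-c\,e^{-c'n}$, $$\left|\frac{R(\widehat\alpha)}{R(\mathbf{0})}-1\right|\le K\sqrt{\frac{n}{\mathrm{r_e}(\Sigma_X)}}.$$ (ii) Consequently, along every sequence of such problems, with a common $M$, for which $n\to\infty$ and $\mathrm{r_e}(\Sigma_X)/n\to\infty$, the ratio $R(\widehat\alpha)/R(\mathbf{0})$ converges to $1$ in probability, so that $\widehat\alpha$ asymptotically does no better than predicting by zero. -/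

import Mathlib

open MeasureTheory ProbabilityTheory Filter
open scoped ENNReal Topology MatrixOrder

universe u v

noncomputable section

namespace NullRisk

/-- The sub-Gaussian (`ψ₂`) norm `inf {t > 0 : E exp(U² / t²) ≤ 2}`, with value `∞` when no such
`t` exists. -/
def psi2Norm {Ω : Type*} [MeasurableSpace Ω] (Q : Measure Ω) (U : Ω → ℝ) : ℝ≥0∞ :=
  sInf {s | ∃ t : ℝ, 0 < t ∧ ∫⁻ ω, ENNReal.ofReal (Real.exp (U ω ^ 2 / t ^ 2)) ∂Q ≤ 2 ∧
    s = ENNReal.ofReal t}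

/-- The covariance matrix of a random vector. -/
def covMatrix {Ω : Type*} [MeasurableSpace Ω] {p : ℕ} (Q : Measure Ω)
    (X : Ω → EuclideanSpace ℝ (Fin p)) : Matrix (Fin p) (Fin p) ℝ :=
  Matrix.of fun i j => cov[fun ω => X ω i, fun ω => X ω j; Q]

/-- The effective rank `tr(S) / ‖S‖`, with `‖S‖` the Euclidean operator norm. -/
def effectiveRank {p : ℕ} (S : Matrix (Fin p) (Fin p) ℝ) : ℝ :=
  S.trace / ‖Matrix.toEuclideanCLM (𝕜 := ℝ) S‖

/-- The prediction risk `R(α) = E[(Xᵀα - y)²]` of a fixed weight vector `α`. -/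
def risk {Ω : Type*} [MeasurableSpace Ω] {p : ℕ} (Q : Measure Ω)
    (X : Ω → EuclideanSpace ℝ (Fin p)) (y : Ω → ℝ) (α : EuclideanSpace ℝ (Fin p)) : ℝ :=
  ∫ ω, (inner ℝ (X ω) α - y ω) ^ 2 ∂Q

/-- `α` minimizes `u ↦ ‖A u - b‖`. -/
def IsLeastSquares {n p : ℕ} (A : Matrix (Fin n) (Fin p) ℝ) (b : EuclideanSpace ℝ (Fin n))
    (α : EuclideanSpace ℝ (Fin p)) : Prop :=
  ∀ u : EuclideanSpace ℝ (Fin p), ‖Matrix.toEuclideanLin A α - b‖ ≤ ‖Matrix.toEuclideanLin A u - b‖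

/-- `α` has the smallest norm among the minimizers of `u ↦ ‖A u - b‖`. -/
def IsMinNormLeastSquares {n p : ℕ} (A : Matrix (Fin n) (Fin p) ℝ)
    (b : EuclideanSpace ℝ (Fin n)) (α : EuclideanSpace ℝ (Fin p)) : Prop :=
  IsLeastSquares A b α ∧ ∀ β, IsLeastSquares A b β → ‖α‖ ≤ ‖β‖

theorem existsUnique_isMinNormLeastSquares {n p : ℕ} (A : Matrix (Fin n) (Fin p) ℝ)
    (b : EuclideanSpace ℝ (Fin n)) : ∃! α, IsMinNormLeastSquares A b α := by
  set L := Matrix.toEuclideanLin A with hL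
  have hcont : Continuous L := LinearMap.continuous_of_finiteDimensional L
  have hne : ∃ α, IsLeastSquares A b α := by
    have hcl : IsClosed (LinearMap.range L : Set (EuclideanSpace ℝ (Fin n))) :=
      Submodule.closed_of_finiteDimensional _
    obtain ⟨z, ⟨α, rfl⟩, hz⟩ := hcl.exists_infDist_eq_dist ⟨0, Submodule.zero_mem _⟩ b
    refine ⟨α, fun u => ?_⟩
    have h : Metric.infDist b (LinearMap.range L : Set (EuclideanSpace ℝ (Fin n))) ≤
        dist b (L u) := Metric.infDist_le_dist_of_mem ⟨u, rfl⟩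
    rw [hz, dist_comm, dist_comm b, dist_eq_norm, dist_eq_norm] at h
    exact h
  have hclosed : IsClosed {α | IsLeastSquares A b α} := by
    simp only [IsLeastSquares, Set.ofPred_forall]
    exact isClosed_iInter fun u =>
      isClosed_le ((hcont.sub continuous_const).norm) continuous_const
  obtain ⟨α, hα, hmin⟩ := hclosed.exists_infDist_eq_dist hne 0
  replace hα : IsLeastSquares A b α := hα
  have hαmin : IsMinNormLeastSquares A b α := by
    refine ⟨hα, fun β hβ => ?_⟩
    have h := Metric.infDist_le_dist_of_mem (x := (0 : EuclideanSpace ℝ (Fin p)))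
      (show β ∈ {α | IsLeastSquares A b α} from Set.mem_ofPred.mpr hβ)
    rw [hmin] at h
    simpa using h
  refine ⟨α, hαmin, fun β hβ => ?_⟩
  have hnorm : ‖β‖ = ‖α‖ := le_antisymm (hβ.2 α hα) (hαmin.2 β hβ.1)
  have hmid : IsLeastSquares A b ((2⁻¹ : ℝ) • (α + β)) := by
    intro u
    have e : L ((2⁻¹ : ℝ) • (α + β)) - b
        = (2⁻¹ : ℝ) • (L α - b) + (2⁻¹ : ℝ) • (L β - b) := by
      rw [map_smul, map_add]
      module
    have h1 := hα u
    have h2 := hβ.1 u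
    calc ‖L ((2⁻¹ : ℝ) • (α + β)) - b‖
        ≤ ‖(2⁻¹ : ℝ) • (L α - b)‖ + ‖(2⁻¹ : ℝ) • (L β - b)‖ := by
          rw [e]; exact norm_add_le _ _
      _ = 2⁻¹ * ‖L α - b‖ + 2⁻¹ * ‖L β - b‖ := by
          rw [norm_smul, norm_smul]; norm_num
      _ ≤ ‖L u - b‖ := by linarith
  have h3 := hαmin.2 _ hmid
  rw [norm_smul] at h3
  have h4 : 2 * ‖α‖ ≤ ‖α + β‖ := by
    have : ‖(2⁻¹ : ℝ)‖ = 2⁻¹ := by norm_num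
    rw [this] at h3
    linarith
  have h5 := parallelogram_law_with_norm ℝ α β
  have h6 : ‖α - β‖ * ‖α - β‖ ≤ 0 := by
    rw [hnorm] at h5
    nlinarith [norm_nonneg α, norm_nonneg (α + β)]
  have h7 : ‖α - β‖ = 0 := by nlinarith [norm_nonneg (α - β)]
  exact (sub_eq_zero.mp (norm_eq_zero.mp h7)).symm

/-- The minimum-norm estimator
`argmin {‖α‖ : ‖A α - b‖ = min_u ‖A u - b‖}`, which interpolates when `A` has full row rank. -/
def minNormEstimator {n p : ℕ} (A : Matrix (Fin n) (Fin p) ℝ)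
    (b : EuclideanSpace ℝ (Fin n)) : EuclideanSpace ℝ (Fin p) :=
  (existsUnique_isMinNormLeastSquares A b).choose

/-- The estimator computed from the sample `(Xs 0, ys 0), …, (Xs (n-1), ys (n-1))`: the rows of the
data matrix are the observed feature vectors. -/
def sampleEstimator {Ω : Type*} {n p : ℕ} (Xs : Fin n → Ω → EuclideanSpace ℝ (Fin p))
    (ys : Fin n → Ω → ℝ) (ω : Ω) : EuclideanSpace ℝ (Fin p) :=
  minNormEstimator (Matrix.of fun i j => Xs i ω j) (WithLp.toLp 2 fun i => ys i ω)

/-- A real random variable with zero mean, unit variance and sub-Gaussian norm at most `M`. -/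
structure IsStdSubGaussian {Ω : Type*} [MeasurableSpace Ω] (Q : Measure Ω) (M : ℝ)
    (U : Ω → ℝ) : Prop where
  aemeasurable : AEMeasurable U Q
  mean_eq_zero : ∫ ω, U ω ∂Q = 0
  variance_eq_one : Var[U; Q] = 1
  psi2Norm_le : psi2Norm Q U ≤ ENNReal.ofReal M

/-- `X = Σ_X^{1/2} X̃` and `y = σ_y ỹ`, where `Σ_X` is the covariance matrix of `X`,
`σ_y² = E[y²]`, the entries of `X̃` are independent, and the entries of `X̃` as well as `ỹ` are
centred with unit variance and sub-Gaussian norm at most `M`. The dependence between `X̃` and `ỹ`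
is arbitrary. -/
def SubGaussianPair {Ω : Type*} [MeasurableSpace Ω] {p : ℕ} (Q : Measure Ω) (M : ℝ)
    (X : Ω → EuclideanSpace ℝ (Fin p)) (y : Ω → ℝ) : Prop :=
  ∃ (X' : Fin p → Ω → ℝ) (y' : Ω → ℝ),
    iIndepFun X' Q ∧ (∀ j, IsStdSubGaussian Q M (X' j)) ∧ IsStdSubGaussian Q M y' ∧
    (∀ᵐ ω ∂Q, X ω = WithLp.toLp 2 (Matrix.mulVec (CFC.sqrt (covMatrix Q X)) fun j => X' j ω)) ∧
    (∀ᵐ ω ∂Q, y ω = √(∫ ω', y ω' ^ 2 ∂Q) * y' ω)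

/-- `(Xs i, ys i)`, `i < n`, are i.i.d. copies of `(X, y)`. -/
structure IsIIDSample {Ω₀ Ω : Type*} [MeasurableSpace Ω₀] [MeasurableSpace Ω] {n p : ℕ}
    (Q : Measure Ω₀) (X : Ω₀ → EuclideanSpace ℝ (Fin p)) (y : Ω₀ → ℝ) (P : Measure Ω)
    (Xs : Fin n → Ω → EuclideanSpace ℝ (Fin p)) (ys : Fin n → Ω → ℝ) : Prop where
  indep : iIndepFun (fun i ω => (Xs i ω, ys i ω)) P
  identDistrib : ∀ i, IdentDistrib (fun ω => (Xs i ω, ys i ω)) (fun ω => (X ω, y ω)) P Q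

end NullRisk

end

/-!
Write `Σ` for the covariance matrix of `X` and `r` for its effective rank. For a unit vector `w`,
`‖∑ i, w i • Xs i‖²` has expectation `tr Σ`. Since `∑ i, w i • Xs i` is `Σ^{1/2}` applied to a
vector with independent sub-Gaussian entries, a bound on its quadratic moment generating function
gives deviation probabilities exponentially small in `r`. For `r` much larger than `n` these survive
a union bound over a net of the unit sphere of `ℝⁿ`, so that all singular values of the data matrix
are of order `√(tr Σ)`. The estimator then interpolates the data and `(tr Σ) ‖α‖²` is at most of
order `‖y‖²`, hence of order `n σ_y²`. Therefore `E (Xᵀα)² ≤ ‖Σ‖ ‖α‖²` is of order `σ_y² n / r`,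
and expanding the square moves the risk away from `σ_y²` by at most `O(√(n / r)) σ_y²`.
-/

namespace NullRisk

/-! ### Exponential moments -/

section ExpMoment

variable {Ω : Type*} [MeasurableSpace Ω]

/-- The exponential moment `E exp f`, as an extended nonnegative real so that no integrability side
conditions have to be carried along. -/
noncomputable def expMoment (μ : Measure Ω) (f : Ω → ℝ) : ℝ≥0∞ :=
  ∫⁻ ω, ENNReal.ofReal (Real.exp (f ω)) ∂μ

variable {μ : Measure Ω} {f g : Ω → ℝ}

theorem expMoment_mono (h : ∀ ω, f ω ≤ g ω) : expMoment μ f ≤ expMoment μ g :=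
  lintegral_mono fun ω => ENNReal.ofReal_le_ofReal (Real.exp_le_exp.mpr (h ω))

theorem expMoment_congr_ae (h : f =ᵐ[μ] g) : expMoment μ f = expMoment μ g :=
  lintegral_congr_ae (h.mono fun ω hω => by simp only [hω])

theorem expMoment_const_add (c : ℝ) (f : Ω → ℝ) :
    expMoment μ (fun ω => c + f ω) = ENNReal.ofReal (Real.exp c) * expMoment μ f := by
  simp only [expMoment, Real.exp_add, ENNReal.ofReal_mul (Real.exp_nonneg c)]
  exact lintegral_const_mul' _ _ ENNReal.ofReal_ne_top

theorem expMoment_map {Ω' : Type*} [MeasurableSpace Ω'] {X : Ω → Ω'} {h : Ω' → ℝ}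
    (hX : AEMeasurable X μ) (hh : Measurable h) :
    expMoment (μ.map X) h = expMoment μ fun ω => h (X ω) :=
  lintegral_map' hh.exp.ennreal_ofReal.aemeasurable hX

theorem expMoment_congr_identDistrib {Ω' E : Type*} [MeasurableSpace Ω'] [MeasurableSpace E]
    {ν : Measure Ω'} {X : Ω → E} {Y : Ω' → E} (hXY : IdentDistrib X Y μ ν) {h : E → ℝ}
    (hh : Measurable h) : expMoment μ (fun ω => h (X ω)) = expMoment ν fun ω => h (Y ω) := by
  rw [← expMoment_map hXY.aemeasurable_fst hh, hXY.map_eq, expMoment_map hXY.aemeasurable_snd hh]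

theorem expMoment_eq_ofReal_integral (h : Integrable (fun ω => Real.exp (f ω)) μ) :
    expMoment μ f = ENNReal.ofReal (∫ ω, Real.exp (f ω) ∂μ) :=
  (ofReal_integral_eq_lintegral_ofReal h (ae_of_all _ fun _ => Real.exp_nonneg _)).symm

theorem integrable_exp_of_expMoment_lt_top (hf : AEMeasurable f μ) (h : expMoment μ f < ∞) :
    Integrable (fun ω => Real.exp (f ω)) μ := by
  refine ⟨hf.exp.aestronglyMeasurable, ?_⟩
  rwa [hasFiniteIntegral_iff_ofReal (ae_of_all _ fun _ => Real.exp_nonneg _)]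

theorem expMoment_add_le (hf : AEMeasurable f μ) (hg : AEMeasurable g μ) {a b : ℝ}
    (ha : expMoment μ (fun ω => 2 * f ω) ≤ ENNReal.ofReal (Real.exp (2 * a)))
    (hb : expMoment μ (fun ω => 2 * g ω) ≤ ENNReal.ofReal (Real.exp (2 * b))) :
    expMoment μ (fun ω => f ω + g ω) ≤ ENNReal.ofReal (Real.exp (a + b)) := by
  have sq_exp (t : ℝ) : ENNReal.ofReal (Real.exp t) ^ (2 : ℝ) =
      ENNReal.ofReal (Real.exp (2 * t)) := by
    rw [ENNReal.ofReal_rpow_of_pos (Real.exp_pos t), ← Real.exp_mul, mul_comm]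
  have sqrt_exp (t : ℝ) : ENNReal.ofReal (Real.exp (2 * t)) ^ (1 / 2 : ℝ) =
      ENNReal.ofReal (Real.exp t) := by
    rw [← sq_exp, ← ENNReal.rpow_mul, mul_one_div_cancel two_ne_zero, ENNReal.rpow_one]
  have cauchy_schwarz := ENNReal.lintegral_mul_le_Lp_mul_Lq μ Real.HolderConjugate.two_two
    hf.exp.ennreal_ofReal hg.exp.ennreal_ofReal
  simp only [Pi.mul_apply, ← ENNReal.ofReal_mul (Real.exp_nonneg _), ← Real.exp_add, sq_exp]
    at cauchy_schwarz
  calc expMoment μ (fun ω => f ω + g ω)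
      ≤ expMoment μ (fun ω => 2 * f ω) ^ (1 / 2 : ℝ) *
          expMoment μ (fun ω => 2 * g ω) ^ (1 / 2 : ℝ) := cauchy_schwarz
    _ ≤ ENNReal.ofReal (Real.exp (2 * a)) ^ (1 / 2 : ℝ) *
          ENNReal.ofReal (Real.exp (2 * b)) ^ (1 / 2 : ℝ) := by gcongr
    _ = ENNReal.ofReal (Real.exp (a + b)) := by
        rw [sqrt_exp, sqrt_exp, ← ENNReal.ofReal_mul (Real.exp_nonneg a), ← Real.exp_add]

theorem measureReal_le_of_expMoment_le (hf : AEMeasurable f μ) {a : ℝ}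
    (h : expMoment μ f ≤ ENNReal.ofReal (Real.exp a)) (t : ℝ) :
    μ.real {ω | t ≤ f ω} ≤ Real.exp (a - t) := by
  refine ENNReal.toReal_le_of_le_ofReal (Real.exp_nonneg _) ?_
  have markov := mul_meas_ge_le_lintegral₀ hf.exp.ennreal_ofReal (ENNReal.ofReal (Real.exp t))
  simp only [ENNReal.ofReal_le_ofReal_iff (Real.exp_nonneg _), Real.exp_le_exp] at markov
  rw [Real.exp_sub, ENNReal.ofReal_div_of_pos (Real.exp_pos t),
    ENNReal.le_div_iff_mul_le (.inl (by positivity)) (.inl ENNReal.ofReal_ne_top), mul_comm]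
  exact markov.trans h

end ExpMoment

/-! ### Random variables of bounded `ψ₂`-norm -/

theorem expMoment_sq_div_sq_le_two_of_psi2Norm_lt {Ω : Type*} [MeasurableSpace Ω] {Q : Measure Ω}
    {U : Ω → ℝ} {T : ℝ} (h : psi2Norm Q U < ENNReal.ofReal T) :
    expMoment Q (fun ω => U ω ^ 2 / T ^ 2) ≤ 2 := by
  obtain ⟨_, ⟨t, ht, hle, rfl⟩, htT⟩ := sInf_lt_iff.mp h
  replace htT : t < T := lt_of_not_ge fun h => htT.not_ge (ENNReal.ofReal_le_ofReal h)
  exact (expMoment_mono fun ω => by gcongr).trans hle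

theorem expMoment_sq_div_sq_le_two {Ω : Type*} [MeasurableSpace Ω] {Q : Measure Ω} {U : Ω → ℝ}
    {T : ℝ} (hU : AEMeasurable U Q) (hT : 0 < T) (h : psi2Norm Q U ≤ ENNReal.ofReal T) :
    expMoment Q (fun ω => U ω ^ 2 / T ^ 2) ≤ 2 := by
  obtain ⟨t, -, htT, ht⟩ := exists_seq_strictAnti_tendsto T
  have hlim (ω : Ω) : Tendsto (fun k => ENNReal.ofReal (Real.exp (U ω ^ 2 / t k ^ 2))) atTop
      (𝓝 (ENNReal.ofReal (Real.exp (U ω ^ 2 / T ^ 2)))) :=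
    ENNReal.tendsto_ofReal ((tendsto_const_nhds.div (ht.pow 2) (by positivity)).rexp)
  have hle (k : ℕ) : expMoment Q (fun ω => U ω ^ 2 / t k ^ 2) ≤ 2 :=
    expMoment_sq_div_sq_le_two_of_psi2Norm_lt
      (h.trans_lt ((ENNReal.ofReal_lt_ofReal_iff (hT.trans (htT k))).mpr (htT k)))
  calc expMoment Q (fun ω => U ω ^ 2 / T ^ 2)
      = ∫⁻ ω, liminf (fun k => ENNReal.ofReal (Real.exp (U ω ^ 2 / t k ^ 2))) atTop ∂Q :=
        lintegral_congr fun ω => (hlim ω).liminf_eq.symm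
    _ ≤ liminf (fun k => expMoment Q fun ω => U ω ^ 2 / t k ^ 2) atTop :=
        lintegral_liminf_le' fun k => by fun_prop
    _ ≤ 2 := (liminf_le_liminf (.of_forall hle)).trans_eq (liminf_const 2)

theorem exp_le_add_exp_sq (x : ℝ) : Real.exp x ≤ x + Real.exp (x ^ 2) := by
  have h2 := Real.add_one_le_exp (x ^ 2)
  rcases le_or_gt |x| 1 with h | h
  · linarith [(abs_le.mp (Real.abs_exp_sub_one_sub_id_le h)).2]
  rcases le_or_gt 0 x with h0 | h0
  · rw [abs_of_nonneg h0] at h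
    have : Real.exp x ≤ Real.exp (x ^ 2) := Real.exp_le_exp.mpr (by nlinarith)
    linarith
  · rw [abs_of_neg h0] at h
    have : Real.exp x ≤ 1 := Real.exp_le_one_iff.mpr h0.le
    nlinarith

theorem exp_neg_le_quadratic {x : ℝ} (hx : 0 ≤ x) : Real.exp (-x) ≤ 1 - x + x ^ 2 / 2 := by
  have hp : 0 < 1 + x + x ^ 2 / 2 := by positivity
  rw [Real.exp_neg]
  refine (inv_anti₀ hp (Real.quadratic_le_exp_of_nonneg hx)).trans ?_
  rw [inv_le_iff_one_le_mul₀ hp]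
  nlinarith [sq_nonneg (x ^ 2)]

section PsiTwo

variable {Ω : Type*} [MeasurableSpace Ω] {Q : Measure Ω} {U : Ω → ℝ} {T a b : ℝ}

theorem integrable_sq_of_expMoment_lt_top (hU : AEMeasurable U Q) (hT : 0 < T)
    (h : expMoment Q (fun ω => U ω ^ 2 / T ^ 2) < ∞) : Integrable (fun ω => U ω ^ 2) Q := by
  refine ((integrable_exp_of_expMoment_lt_top (by fun_prop) h).const_mul (T ^ 2)).mono'
    (by fun_prop) (ae_of_all _ fun ω => ?_)
  rw [Real.norm_of_nonneg (sq_nonneg _), ← div_le_iff₀' (by positivity)]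
  linarith [Real.add_one_le_exp (U ω ^ 2 / T ^ 2)]

theorem integral_pow_four_le (hU : AEMeasurable U Q) (hT : 0 < T)
    (h : expMoment Q (fun ω => U ω ^ 2 / T ^ 2) ≤ 2) :
    Integrable (fun ω => U ω ^ 4) Q ∧ ∫ ω, U ω ^ 4 ∂Q ≤ 4 * T ^ 4 := by
  have hexp := integrable_exp_of_expMoment_lt_top (by fun_prop) (h.trans_lt ENNReal.ofNat_lt_top)
  have hpow (ω : Ω) : U ω ^ 4 ≤ 2 * T ^ 4 * Real.exp (U ω ^ 2 / T ^ 2) := by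
    have hx : 0 ≤ U ω ^ 2 / T ^ 2 := by positivity
    calc U ω ^ 4 = T ^ 4 * (U ω ^ 2 / T ^ 2) ^ 2 := by field_simp
      _ ≤ T ^ 4 * (2 * Real.exp (U ω ^ 2 / T ^ 2)) := by
          gcongr; linarith [Real.quadratic_le_exp_of_nonneg hx]
      _ = _ := by ring
  have hint : Integrable (fun ω => U ω ^ 4) Q :=
    (hexp.const_mul _).mono' (by fun_prop) (ae_of_all _ fun ω => by
      rw [Real.norm_of_nonneg (by positivity)]; exact hpow ω)
  refine ⟨hint, ?_⟩
  rw [expMoment_eq_ofReal_integral hexp, ENNReal.ofReal_le_ofNat] at h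
  calc ∫ ω, U ω ^ 4 ∂Q ≤ ∫ ω, 2 * T ^ 4 * Real.exp (U ω ^ 2 / T ^ 2) ∂Q :=
        integral_mono hint (hexp.const_mul _) hpow
    _ = 2 * T ^ 4 * ∫ ω, Real.exp (U ω ^ 2 / T ^ 2) ∂Q := integral_const_mul _ _
    _ ≤ 2 * T ^ 4 * 2 := by gcongr
    _ = 4 * T ^ 4 := by ring

variable [IsProbabilityMeasure Q]

theorem expMoment_mul_sq_le (hT : 0 < T) (h : expMoment Q (fun ω => U ω ^ 2 / T ^ 2) ≤ 2)
    (ha : 0 ≤ a) (haT : a * T ^ 2 ≤ 1) :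
    expMoment Q (fun ω => a * U ω ^ 2) ≤ ENNReal.ofReal (Real.exp (a * T ^ 2)) := by
  set t := a * T ^ 2 with ht_def
  have ht : 0 ≤ t := by positivity
  have convex (ω : Ω) : ENNReal.ofReal (Real.exp (a * U ω ^ 2)) ≤
      ENNReal.ofReal (1 - t) +
        ENNReal.ofReal t * ENNReal.ofReal (Real.exp (U ω ^ 2 / T ^ 2)) := by
    rw [← ENNReal.ofReal_mul ht, ← ENNReal.ofReal_add (by linarith) (by positivity),
      show a * U ω ^ 2 = t * (U ω ^ 2 / T ^ 2) by rw [ht_def]; field_simp]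
    refine ENNReal.ofReal_le_ofReal ?_
    simpa using convexOn_exp.2 (Set.mem_univ 0) (Set.mem_univ (U ω ^ 2 / T ^ 2))
      (sub_nonneg.mpr haT) ht (by ring)
  calc expMoment Q (fun ω => a * U ω ^ 2)
      ≤ ENNReal.ofReal (1 - t) + ENNReal.ofReal t * expMoment Q (fun ω => U ω ^ 2 / T ^ 2) := by
        refine (lintegral_mono convex).trans_eq ?_
        rw [lintegral_add_left (by fun_prop), lintegral_const_mul' _ _ ENNReal.ofReal_ne_top,
          lintegral_const, measure_univ, mul_one, expMoment]
    _ ≤ ENNReal.ofReal (1 - t) + ENNReal.ofReal t * ENNReal.ofReal 2 := by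
        rw [ENNReal.ofReal_ofNat]; gcongr
    _ = ENNReal.ofReal (t + 1) := by
        rw [← ENNReal.ofReal_mul ht, ← ENNReal.ofReal_add (by linarith) (by positivity)]
        congr 1; ring
    _ ≤ _ := ENNReal.ofReal_le_ofReal (Real.add_one_le_exp t)

theorem expMoment_mul_le_of_sq_mul_le_one (hU : AEMeasurable U Q) (hT : 0 < T)
    (h : expMoment Q (fun ω => U ω ^ 2 / T ^ 2) ≤ 2) (hmean : ∫ ω, U ω ∂Q = 0)
    (hb : b ^ 2 * T ^ 2 ≤ 1) :
    expMoment Q (fun ω => b * U ω) ≤ ENNReal.ofReal (Real.exp (b ^ 2 * T ^ 2)) := by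
  have hsq := expMoment_mul_sq_le hT h (sq_nonneg b) hb
  have hU2 := integrable_sq_of_expMoment_lt_top hU hT (h.trans_lt ENNReal.ofNat_lt_top)
  have hlin : Integrable (fun ω => b * U ω) Q :=
    (((memLp_two_iff_integrable_sq hU.aestronglyMeasurable).mpr hU2).integrable
      one_le_two).const_mul b
  have hgauss : Integrable (fun ω => Real.exp (b ^ 2 * U ω ^ 2)) Q :=
    integrable_exp_of_expMoment_lt_top (by fun_prop) (hsq.trans_lt ENNReal.ofReal_lt_top)
  have hle (ω : Ω) : Real.exp (b * U ω) ≤ b * U ω + Real.exp (b ^ 2 * U ω ^ 2) := by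
    rw [← mul_pow]; exact exp_le_add_exp_sq _
  have hexp : Integrable (fun ω => Real.exp (b * U ω)) Q :=
    (hlin.add hgauss).mono' (by fun_prop) (ae_of_all _ fun ω => by
      rw [Real.norm_of_nonneg (Real.exp_nonneg _)]; exact hle ω)
  refine le_trans ?_ hsq
  rw [expMoment_eq_ofReal_integral hexp, expMoment_eq_ofReal_integral hgauss]
  refine ENNReal.ofReal_le_ofReal ((integral_mono hexp (hlin.add hgauss) hle).trans_eq ?_)
  rw [integral_add' hlin hgauss, integral_const_mul, hmean, mul_zero, zero_add]

theorem expMoment_mul_le_of_one_le_sq_mul (hT : 0 < T)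
    (h : expMoment Q (fun ω => U ω ^ 2 / T ^ 2) ≤ 2) (hb : 1 ≤ b ^ 2 * T ^ 2) :
    expMoment Q (fun ω => b * U ω) ≤ ENNReal.ofReal (Real.exp (b ^ 2 * T ^ 2)) := by
  have young (ω : Ω) : b * U ω ≤ b ^ 2 * T ^ 2 / 2 + 1 / (2 * T ^ 2) * U ω ^ 2 := by
    have : b ^ 2 * T ^ 2 / 2 + 1 / (2 * T ^ 2) * U ω ^ 2 - b * U ω = (b * T - U ω / T) ^ 2 / 2 := by
      field_simp; ring
    linarith [sq_nonneg (b * T - U ω / T)]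
  have half : 1 / (2 * T ^ 2) * T ^ 2 = 1 / 2 := by field_simp
  calc expMoment Q (fun ω => b * U ω)
      ≤ ENNReal.ofReal (Real.exp (b ^ 2 * T ^ 2 / 2)) *
          expMoment Q (fun ω => 1 / (2 * T ^ 2) * U ω ^ 2) :=
        (expMoment_mono young).trans_eq (expMoment_const_add _ _)
    _ ≤ ENNReal.ofReal (Real.exp (b ^ 2 * T ^ 2 / 2)) * ENNReal.ofReal (Real.exp (1 / 2)) := by
        gcongr
        exact (expMoment_mul_sq_le hT h (by positivity) (by rw [half]; norm_num)).trans_eq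
          (by rw [half])
    _ = ENNReal.ofReal (Real.exp (b ^ 2 * T ^ 2 / 2 + 1 / 2)) := by
        rw [← ENNReal.ofReal_mul (Real.exp_nonneg _), ← Real.exp_add]
    _ ≤ _ := ENNReal.ofReal_le_ofReal (Real.exp_le_exp.mpr (by linarith))

theorem expMoment_mul_le (hU : AEMeasurable U Q) (hT : 0 < T)
    (h : expMoment Q (fun ω => U ω ^ 2 / T ^ 2) ≤ 2) (hmean : ∫ ω, U ω ∂Q = 0) (b : ℝ) :
    expMoment Q (fun ω => b * U ω) ≤ ENNReal.ofReal (Real.exp (b ^ 2 * T ^ 2)) :=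
  (le_total (b ^ 2 * T ^ 2) 1).elim (expMoment_mul_le_of_sq_mul_le_one hU hT h hmean)
    (expMoment_mul_le_of_one_le_sq_mul hT h)

theorem expMoment_neg_mul_sq_le (hU : AEMeasurable U Q) (hT : 0 < T)
    (h : expMoment Q (fun ω => U ω ^ 2 / T ^ 2) ≤ 2) (hvar : ∫ ω, U ω ^ 2 ∂Q = 1) (ha : 0 ≤ a) :
    expMoment Q (fun ω => -(a * U ω ^ 2)) ≤ ENNReal.ofReal (Real.exp (-a + 2 * T ^ 4 * a ^ 2)) := by
  have h2 := integrable_sq_of_expMoment_lt_top hU hT (h.trans_lt ENNReal.ofNat_lt_top)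
  obtain ⟨h4, h4_le⟩ := integral_pow_four_le hU hT h
  have hexp : Integrable (fun ω => Real.exp (-(a * U ω ^ 2))) Q :=
    (integrable_const (1 : ℝ)).mono' (by fun_prop) (ae_of_all _ fun ω => by
      rw [Real.norm_of_nonneg (Real.exp_nonneg _), Real.exp_le_one_iff]
      exact neg_nonpos.mpr (by positivity))
  have hlin : Integrable (fun ω => 1 - a * U ω ^ 2) Q := (integrable_const 1).sub (h2.const_mul a)
  rw [expMoment_eq_ofReal_integral hexp]
  refine ENNReal.ofReal_le_ofReal ?_
  calc ∫ ω, Real.exp (-(a * U ω ^ 2)) ∂Q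
      ≤ ∫ ω, ((1 - a * U ω ^ 2) + a ^ 2 / 2 * U ω ^ 4) ∂Q :=
        integral_mono hexp (hlin.add (h4.const_mul _)) fun ω =>
          (exp_neg_le_quadratic (by positivity)).trans_eq (by ring)
    _ = 1 - a + a ^ 2 / 2 * ∫ ω, U ω ^ 4 ∂Q := by
        rw [integral_add hlin (h4.const_mul _), integral_sub (integrable_const 1) (h2.const_mul a),
          integral_const_mul, integral_const_mul, hvar, integral_const, probReal_univ, one_smul,
          mul_one]
    _ ≤ 1 - a + a ^ 2 / 2 * (4 * T ^ 4) := by gcongr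
    _ = (-a + 2 * T ^ 4 * a ^ 2) + 1 := by ring
    _ ≤ _ := Real.add_one_le_exp _

end PsiTwo

/-! ### Exponential moments of quadratic forms in independent variables -/

section QuadraticMGFBound

variable {Ω : Type*} [MeasurableSpace Ω]

/-- `E exp(s a U² + b U) ≤ exp(k a + C b²)` for all `a ∈ [0, η]` and `b ∈ ℝ`. The linear term is
what the other coordinates of a quadratic form contribute to a given one, so a bound of this shape
can be integrated out one coordinate at a time; the sign of `s` selects the upper or the lower
tail. -/
def HasQuadraticMGFBound (Q : Measure Ω) (U : Ω → ℝ) (s η k C : ℝ) : Prop :=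
  ∀ a ∈ Set.Icc 0 η, ∀ b : ℝ,
    expMoment Q (fun ω => s * (a * U ω ^ 2) + b * U ω) ≤
      ENNReal.ofReal (Real.exp (k * a + C * b ^ 2))

variable {Q : Measure Ω} {U : Ω → ℝ} {s η k C T : ℝ}

theorem hasQuadraticMGFBound_map_iff (hU : AEMeasurable U Q) :
    HasQuadraticMGFBound (Q.map U) id s η k C ↔ HasQuadraticMGFBound Q U s η k C :=
  forall₂_congr fun a _ => forall_congr' fun b => by rw [expMoment_map hU (by fun_prop)]; rfl

theorem hasQuadraticMGFBound_one [IsProbabilityMeasure Q] (hU : AEMeasurable U Q) (hT : 0 < T)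
    (h : expMoment Q (fun ω => U ω ^ 2 / T ^ 2) ≤ 2) (hmean : ∫ ω, U ω ∂Q = 0)
    (hη : 2 * η * T ^ 2 ≤ 1) : HasQuadraticMGFBound Q U 1 η (T ^ 2) (2 * T ^ 2) := by
  rintro a ⟨ha, haη⟩ b
  refine expMoment_add_le (by fun_prop) (by fun_prop) ?_ ?_
  · calc expMoment Q (fun ω => 2 * (1 * (a * U ω ^ 2)))
        = expMoment Q (fun ω => 2 * a * U ω ^ 2) := by simp only [one_mul, mul_assoc]
      _ ≤ ENNReal.ofReal (Real.exp (2 * a * T ^ 2)) :=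
        expMoment_mul_sq_le hT h (by positivity) (hη.trans' (by gcongr))
      _ = _ := by ring_nf
  · calc expMoment Q (fun ω => 2 * (b * U ω))
        = expMoment Q (fun ω => 2 * b * U ω) := by simp only [mul_assoc]
      _ ≤ _ := expMoment_mul_le hU hT h hmean (2 * b)
      _ = _ := by ring_nf

theorem hasQuadraticMGFBound_neg_one [IsProbabilityMeasure Q] (hU : AEMeasurable U Q) (hT : 0 < T)
    (h : expMoment Q (fun ω => U ω ^ 2 / T ^ 2) ≤ 2) (hmean : ∫ ω, U ω ∂Q = 0)
    (hvar : ∫ ω, U ω ^ 2 ∂Q = 1) (hη : 16 * η * T ^ 4 ≤ 1) :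
    HasQuadraticMGFBound Q U (-1) η (-(3 / 4)) (2 * T ^ 2) := by
  rintro a ⟨ha, haη⟩ b
  refine expMoment_add_le (by fun_prop) (by fun_prop) ?_ ?_
  · calc expMoment Q (fun ω => 2 * (-1 * (a * U ω ^ 2)))
        = expMoment Q (fun ω => -(2 * a * U ω ^ 2)) := by ring_nf
      _ ≤ ENNReal.ofReal (Real.exp (-(2 * a) + 2 * T ^ 4 * (2 * a) ^ 2)) :=
        expMoment_neg_mul_sq_le hU hT h hvar (by positivity)
      _ ≤ _ := by
        refine ENNReal.ofReal_le_ofReal (Real.exp_le_exp.mpr ?_)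
        have : 16 * a * T ^ 4 ≤ 1 := hη.trans' (by gcongr)
        nlinarith
  · calc expMoment Q (fun ω => 2 * (b * U ω))
        = expMoment Q (fun ω => 2 * b * U ω) := by simp only [mul_assoc]
      _ ≤ _ := expMoment_mul_le hU hT h hmean (2 * b)
      _ = _ := by ring_nf

end QuadraticMGFBound

section RankOneUpdate

open Matrix

variable {m : ℕ} {A : Matrix (Fin (m + 1)) (Fin (m + 1)) ℝ} {η c : ℝ}

theorem vecCons_dotProduct_mulVec_vecCons (hA : A.IsSymm) (t : ℝ) (w : Fin m → ℝ) :
    vecCons t w ⬝ᵥ A *ᵥ vecCons t w =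
      A 0 0 * t ^ 2 + 2 * t * (vecTail (A 0) ⬝ᵥ w) + w ⬝ᵥ A.submatrix Fin.succ Fin.succ *ᵥ w := by
  have hcol : (fun j : Fin m => A j.succ 0) = vecTail (A 0) := funext fun j => hA.apply 0 j.succ
  have hmul : A *ᵥ vecCons t w = vecCons (A 0 0 * t + vecTail (A 0) ⬝ᵥ w)
      (t • vecTail (A 0) + A.submatrix Fin.succ Fin.succ *ᵥ w) := by
    ext i
    cases i using Fin.cases
    · exact dotProduct_cons (A 0) t w
    · rw [← hcol]
      exact (dotProduct_cons (A _) t w).trans (by rw [mul_comm]; rfl)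
  rw [hmul, cons_dotProduct_cons, dotProduct_add, dotProduct_smul, smul_eq_mul, dotProduct_comm w]
  ring

/-- Nonnegativity of the Schur complement of the corner entry, multiplied out so that the corner is
allowed to vanish. -/
theorem vecMulVec_vecTail_le (hA : 0 ≤ A) :
    vecMulVec (vecTail (A 0)) (vecTail (A 0)) ≤ A 0 0 • A.submatrix Fin.succ Fin.succ := by
  have hsymm : A.IsSymm := hA.posSemidef.isHermitian
  have hvec := (posSemidef_vecMulVec_self_star (vecTail (A 0))).isHermitian
  rw [Matrix.le_iff]
  refine .of_dotProduct_mulVec_nonneg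
    (((hA.posSemidef.isHermitian.submatrix _).smul (.all _)).sub hvec) fun w => ?_
  have hdiscr := discrim_le_zero (a := A 0 0) (b := 2 * (vecTail (A 0) ⬝ᵥ w))
    (c := w ⬝ᵥ A.submatrix Fin.succ Fin.succ *ᵥ w) fun t => by
      have := hA.posSemidef.dotProduct_mulVec_nonneg (vecCons t w)
      rw [star_trivial, vecCons_dotProduct_mulVec_vecCons hsymm] at this
      linarith
  rw [discrim] at hdiscr
  rw [star_trivial, sub_mulVec, smul_mulVec, vecMulVec_mulVec, op_smul_eq_smul, dotProduct_sub,
    dotProduct_smul, dotProduct_smul, smul_eq_mul, smul_eq_mul, dotProduct_comm w (vecTail _)]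
  linarith

theorem smul_vecMulVec_vecTail_le (hA : 0 ≤ A) (hAη : A 0 0 ≤ η) (hc : 0 ≤ c) (hcη : c * η ≤ 1) :
    c • vecMulVec (vecTail (A 0)) (vecTail (A 0)) ≤ A.submatrix Fin.succ Fin.succ := by
  have hsub : 0 ≤ A.submatrix Fin.succ Fin.succ := (hA.posSemidef.submatrix _).nonneg
  calc c • vecMulVec (vecTail (A 0)) (vecTail (A 0))
      ≤ c • A 0 0 • A.submatrix Fin.succ Fin.succ := by
        gcongr; exact vecMulVec_vecTail_le hA
    _ = (c * A 0 0) • A.submatrix Fin.succ Fin.succ := smul_smul _ _ _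
    _ ≤ (1 : ℝ) • A.submatrix Fin.succ Fin.succ := by
        gcongr; exact (by gcongr : c * A 0 0 ≤ c * η).trans hcη
    _ = A.submatrix Fin.succ Fin.succ := one_smul _ _

theorem submatrix_add_smul_vecMulVec_nonneg (hA : 0 ≤ A) (hAη : A 0 0 ≤ η) (hc : |c| * η ≤ 1) :
    0 ≤ A.submatrix Fin.succ Fin.succ + c • vecMulVec (vecTail (A 0)) (vecTail (A 0)) := by
  have hvec : 0 ≤ vecMulVec (vecTail (A 0)) (vecTail (A 0)) :=
    (posSemidef_vecMulVec_self_star (vecTail (A 0))).nonneg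
  rw [← neg_le_iff_add_nonneg, ← neg_smul]
  exact (smul_le_smul_of_nonneg_right (neg_le_abs c) hvec).trans
    (smul_vecMulVec_vecTail_le hA hAη (abs_nonneg c) hc)

theorem submatrix_add_smul_vecMulVec_le (hA : 0 ≤ A) (hAη : A ≤ η • 1) (hc : |c| * η ≤ 1) :
    A.submatrix Fin.succ Fin.succ + c • vecMulVec (vecTail (A 0)) (vecTail (A 0)) ≤ η • 1 := by
  have h := submatrix_add_smul_vecMulVec_nonneg (η := η) (c := -c) (sub_nonneg.mpr hAη)
    (by simpa using hA.posSemidef.diag_nonneg (i := 0)) (by rwa [abs_neg])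
  have htail : vecTail ((η • 1 - A) 0) = -vecTail (A 0) := by
    ext j; simp [vecTail, (Fin.succ_ne_zero j).symm]
  have hsub : (η • 1 - A).submatrix Fin.succ Fin.succ = η • 1 - A.submatrix Fin.succ Fin.succ := by
    ext i j; simp [one_apply]
  rw [htail, hsub, neg_vecMulVec, vecMulVec_neg, neg_neg, neg_smul, ← sub_eq_add_neg, sub_sub] at h
  exact sub_nonneg.mp h

theorem vecTail_dotProduct_self_le (hA : 0 ≤ A) (hAη : A ≤ η • 1) :
    vecTail (A 0) ⬝ᵥ vecTail (A 0) ≤ η * A 0 0 := by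
  have hcomm : Commute A (η • 1 - A) := ((Commute.one_right A).smul_right η).sub_right (.refl A)
  have h := (hcomm.mul_nonneg hA (sub_nonneg.mpr hAη)).posSemidef.diag_nonneg (i := 0)
  have hcol (j : Fin m) : A j.succ 0 = A 0 j.succ := hA.posSemidef.isHermitian.apply 0 j.succ
  rw [mul_sub, mul_smul_comm, mul_one, Matrix.sub_apply, Matrix.smul_apply, smul_eq_mul,
    mul_apply, Fin.sum_univ_succ] at h
  simp only [hcol] at h
  have : vecTail (A 0) ⬝ᵥ vecTail (A 0) = ∑ j : Fin m, A 0 j.succ * A 0 j.succ := rfl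
  linarith [mul_self_nonneg (A 0 0)]

end RankOneUpdate

section QuadraticForm

open Matrix

theorem expMoment_pi_succ_le {m : ℕ} (μ : Fin (m + 1) → Measure ℝ) [∀ i, SigmaFinite (μ i)]
    {f : (Fin (m + 1) → ℝ) → ℝ} (hf : Measurable f) {g : (Fin m → ℝ) → ℝ}
    (h : ∀ w, expMoment (μ 0) (fun t => f (vecCons t w)) ≤ ENNReal.ofReal (Real.exp (g w))) :
    expMoment (Measure.pi μ) f ≤ expMoment (Measure.pi fun j : Fin m => μ j.succ) g := by
  have hmp := (measurePreserving_piFinSuccAbove μ 0).symm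
  rw [expMoment, ← hmp.lintegral_comp_emb (MeasurableEquiv.measurableEmbedding _)]
  refine (lintegral_prod_symm' _
    (hf.exp.ennreal_ofReal.comp (MeasurableEquiv.measurable _))).trans_le ?_
  refine lintegral_mono fun w => ?_
  simpa [expMoment, MeasurableEquiv.piFinSuccAbove, Fin.insertNthEquiv, vecCons] using h w

variable {s C η k κ : ℝ}

theorem HasQuadraticMGFBound.expMoment_vecCons_le {ν : Measure ℝ}
    (hν : HasQuadraticMGFBound ν id s η k C) {m : ℕ}
    {A : Matrix (Fin (m + 1)) (Fin (m + 1)) ℝ} (hA : A.IsSymm) (h0 : A 0 0 ∈ Set.Icc 0 η)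
    (w : Fin m → ℝ) :
    expMoment ν (fun t => s * (vecCons t w ⬝ᵥ A *ᵥ vecCons t w)) ≤
      ENNReal.ofReal (Real.exp (k * A 0 0 + s * (w ⬝ᵥ (A.submatrix Fin.succ Fin.succ +
        (4 * s * C) • vecMulVec (vecTail (A 0)) (vecTail (A 0))) *ᵥ w))) := by
  set a := vecTail (A 0)
  set A' := A.submatrix Fin.succ Fin.succ
  have hupdate : w ⬝ᵥ (A' + (4 * s * C) • vecMulVec a a) *ᵥ w =
      w ⬝ᵥ A' *ᵥ w + 4 * s * C * (a ⬝ᵥ w) ^ 2 := by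
    rw [add_mulVec, smul_mulVec, dotProduct_add, dotProduct_smul, vecMulVec_mulVec, smul_eq_mul,
      op_smul_eq_smul, dotProduct_smul, smul_eq_mul, dotProduct_comm w a, sq]
  calc expMoment ν (fun t => s * (vecCons t w ⬝ᵥ A *ᵥ vecCons t w))
      = expMoment ν (fun t => s * (w ⬝ᵥ A' *ᵥ w) +
          (s * (A 0 0 * t ^ 2) + 2 * s * (a ⬝ᵥ w) * t)) := by
        congr 1 with t
        rw [vecCons_dotProduct_mulVec_vecCons hA]; ring
    _ ≤ ENNReal.ofReal (Real.exp (s * (w ⬝ᵥ A' *ᵥ w))) *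
          ENNReal.ofReal (Real.exp (k * A 0 0 + C * (2 * s * (a ⬝ᵥ w)) ^ 2)) := by
        rw [expMoment_const_add]
        gcongr
        exact hν _ h0 _
    _ = _ := by
        rw [← ENNReal.ofReal_mul (Real.exp_nonneg _), ← Real.exp_add, hupdate]
        congr 2; ring

theorem expMoment_quadraticForm_pi_le (hC : 0 ≤ C) (hsη : 4 * |s| * C * η ≤ 1)
    (hκ : k + 4 * C * η * |s * κ| ≤ κ) {m : ℕ} (μ : Fin m → Measure ℝ)
    [∀ i, IsProbabilityMeasure (μ i)] (hμ : ∀ i, HasQuadraticMGFBound (μ i) id s η k C)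
    {A : Matrix (Fin m) (Fin m) ℝ} (hA : 0 ≤ A) (hAη : A ≤ η • 1) :
    expMoment (Measure.pi μ) (fun x => s * (x ⬝ᵥ A *ᵥ x)) ≤
      ENNReal.ofReal (Real.exp (κ * A.trace)) := by
  induction m with
  | zero => simp [expMoment, dotProduct, Matrix.trace]
  | succ m ih =>
    have hsymm : A.IsSymm := hA.posSemidef.isHermitian
    have h0 : A 0 0 ∈ Set.Icc 0 η :=
      ⟨hA.posSemidef.diag_nonneg, by simpa using (Matrix.le_iff.mp hAη).diag_nonneg (i := 0)⟩
    have hc : |4 * s * C| * η ≤ 1 := by rwa [abs_mul, abs_mul, abs_of_nonneg hC, Nat.abs_ofNat]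
    set a := vecTail (A 0)
    set B := A.submatrix Fin.succ Fin.succ + (4 * s * C) • vecMulVec a a with hB
    have htrace : k * A 0 0 + κ * B.trace ≤ κ * A.trace := by
      have ha : a ⬝ᵥ a ≤ η * A 0 0 := vecTail_dotProduct_self_le hA hAη
      have ha0 : 0 ≤ a ⬝ᵥ a := by simpa using dotProduct_self_star_nonneg a
      have hAtr : A.trace = A 0 0 + (A.submatrix Fin.succ Fin.succ).trace :=
        Fin.sum_univ_succ fun i => A i i
      rw [hB, trace_add, trace_smul, trace_vecMulVec, smul_eq_mul, hAtr]
      have h1 : 4 * C * (s * κ) * (a ⬝ᵥ a) ≤ 4 * C * |s * κ| * (η * A 0 0) := by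
        gcongr; exact le_abs_self _
      nlinarith [mul_le_mul_of_nonneg_right hκ h0.1]
    calc expMoment (Measure.pi μ) (fun x => s * (x ⬝ᵥ A *ᵥ x))
        ≤ expMoment (Measure.pi fun j : Fin m => μ j.succ)
            (fun w => k * A 0 0 + s * (w ⬝ᵥ B *ᵥ w)) :=
          expMoment_pi_succ_le μ (by simp only [dotProduct, mulVec]; fun_prop)
            ((hμ 0).expMoment_vecCons_le hsymm h0)
      _ ≤ ENNReal.ofReal (Real.exp (k * A 0 0)) * ENNReal.ofReal (Real.exp (κ * B.trace)) := by
          rw [expMoment_const_add]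
          gcongr
          exact ih _ (fun j => hμ j.succ) (submatrix_add_smul_vecMulVec_nonneg hA h0.2 hc)
            (submatrix_add_smul_vecMulVec_le hA hAη hc)
      _ ≤ _ := by
          rw [← ENNReal.ofReal_mul (Real.exp_nonneg _), ← Real.exp_add]
          exact ENNReal.ofReal_le_ofReal (Real.exp_le_exp.mpr htrace)

variable {ι Ω : Type*} [Fintype ι] [DecidableEq ι] [MeasurableSpace Ω] {P : Measure Ω}

theorem expMoment_quadraticForm_le {Z : ι → Ω → ℝ} (hZ : iIndepFun Z P)
    (hZm : ∀ i, AEMeasurable (Z i) P) (hC : 0 ≤ C) (hsη : 4 * |s| * C * η ≤ 1)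
    (hκ : k + 4 * C * η * |s * κ| ≤ κ) (hμ : ∀ i, HasQuadraticMGFBound P (Z i) s η k C)
    {A : Matrix ι ι ℝ} (hA : 0 ≤ A) (hAη : A ≤ η • 1) :
    expMoment P (fun ω => s * ((fun i => Z i ω) ⬝ᵥ A *ᵥ fun i => Z i ω)) ≤
      ENNReal.ofReal (Real.exp (κ * A.trace)) := by
  let e := (Fintype.equivFin ι).symm
  have : IsProbabilityMeasure P := hZ.isProbabilityMeasure
  have (i : _) : IsProbabilityMeasure (P.map (Z (e i))) :=
    Measure.isProbabilityMeasure_map (hZm _)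
  have hmap := (iIndepFun_iff_map_fun_eq_pi_map fun i => hZm (e i)).mp (hZ.precomp e.injective)
  have hreindex (ω : Ω) : (fun i => Z i ω) ⬝ᵥ A *ᵥ (fun i => Z i ω) =
      (fun i => Z (e i) ω) ⬝ᵥ A.submatrix e e *ᵥ (fun i => Z (e i) ω) := by
    rw [submatrix_mulVec_equiv, ← comp_equiv_dotProduct_comp_equiv _ _ e]
    simp [Function.comp_def]
  have hAe : A.submatrix e e ≤ η • 1 := by
    rw [Matrix.le_iff]
    convert (Matrix.le_iff.mp hAη).submatrix e
    simp [submatrix_sub, submatrix_smul]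
  calc expMoment P (fun ω => s * ((fun i => Z i ω) ⬝ᵥ A *ᵥ fun i => Z i ω))
      = expMoment (Measure.pi fun i => P.map (Z (e i)))
          (fun x => s * (x ⬝ᵥ A.submatrix e e *ᵥ x)) := by
        rw [← hmap, expMoment_map (by fun_prop) (by simp only [dotProduct, mulVec]; fun_prop)]
        simp only [hreindex]
    _ ≤ ENNReal.ofReal (Real.exp (κ * (A.submatrix e e).trace)) :=
        expMoment_quadraticForm_pi_le hC hsη hκ _
          (fun i => (hasQuadraticMGFBound_map_iff (hZm _)).mpr (hμ (e i)))
          (hA.posSemidef.submatrix e).nonneg hAe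
    _ = _ := by rw [show (A.submatrix e e).trace = A.trace from e.sum_comp fun i => A i i]

end QuadraticForm

/-! ### Linear combinations of independent random vectors -/

section Kronecker

open Matrix
open scoped Kronecker

variable {ι κ : Type*} [Fintype ι]

theorem vec_transpose_dotProduct_kronecker_mulVec [Fintype κ] (w : ι → ℝ) (A : Matrix κ κ ℝ)
    (Z : Matrix ι κ ℝ) :
    vec Zᵀ ⬝ᵥ (vecMulVec w w ⊗ₖ A) *ᵥ vec Zᵀ = (w ᵥ* Z) ⬝ᵥ A *ᵥ (w ᵥ* Z) := by
  rw [kronecker_mulVec_vec, vec_dotProduct_vec, transpose_transpose, transpose_vecMulVec,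
    mul_vecMulVec, mul_vecMulVec, trace_vecMulVec, dotProduct_comm, dotProduct_mulVec,
    ← mulVec_mulVec, mulVec_transpose]

variable [DecidableEq ι]

theorem vecMulVec_self_le_one {w : ι → ℝ} (hw : w ⬝ᵥ w = 1) : vecMulVec w w ≤ 1 := by
  have hproj : IsStarProjection (vecMulVec w w) := by
    refine ⟨?_, (posSemidef_vecMulVec_self_star w).isHermitian⟩
    rw [IsIdempotentElem, vecMulVec_mul_vecMulVec, hw, one_smul]
  exact sub_nonneg.mp hproj.one_sub.nonneg

theorem vecMulVec_kronecker_le [Finite κ] [DecidableEq κ] {w : ι → ℝ} (hw : w ⬝ᵥ w = 1)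
    {A : Matrix κ κ ℝ} {η : ℝ} (hη : 0 ≤ η) (hAη : A ≤ η • 1) : vecMulVec w w ⊗ₖ A ≤ η • 1 := by
  cases nonempty_fintype κ
  have hwA : vecMulVec w w ⊗ₖ A ≤ vecMulVec w w ⊗ₖ (η • 1) := by
    rw [Matrix.le_iff]
    convert (posSemidef_vecMulVec_self_star w).kronecker (Matrix.le_iff.mp hAη)
    ext ⟨i, j⟩ ⟨i', j'⟩
    exact (mul_sub _ _ _).symm
  have hw1 : vecMulVec w w ⊗ₖ (η • 1) ≤ (1 : Matrix ι ι ℝ) ⊗ₖ (η • 1 : Matrix κ κ ℝ) := by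
    rw [Matrix.le_iff]
    convert (Matrix.le_iff.mp (vecMulVec_self_le_one hw)).kronecker
      ((PosSemidef.one (n := κ)).smul hη)
    ext ⟨i, j⟩ ⟨i', j'⟩
    exact (sub_mul _ _ _).symm
  rw [kronecker_smul _ 1, one_kronecker_one] at hw1
  exact hwA.trans hw1

end Kronecker

section LinearCombination

open Matrix
open scoped Kronecker

variable {ι κ : Type*} [Fintype ι] [Fintype κ]

theorem iIndepFun_pi_eval_eval (μ : κ → Measure ℝ) [∀ j, IsProbabilityMeasure (μ j)] :
    iIndepFun (fun (q : ι × κ) (x : ι → κ → ℝ) => x q.1 q.2)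
      (Measure.pi fun _ : ι => Measure.pi μ) := by
  have hrows : iIndepFun (fun (i : ι) (x : ι → κ → ℝ) => x i) (Measure.pi fun _ => Measure.pi μ) :=
    iIndepFun_pi (X := fun _ => id) fun _ => by fun_prop
  refine iIndepFun_uncurry' (X := fun i j (x : ι → κ → ℝ) => x i j) (fun _ _ => by fun_prop)
    hrows fun i => ?_
  have hrow := measurePreserving_eval (fun _ : ι => Measure.pi μ) i
  refine (iIndepFun_iff_map_fun_eq_pi_map fun j =>
    (by fun_prop : Measurable fun x : ι → κ → ℝ => x i j).aemeasurable).mpr ?_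
  have hentry (j : κ) : (Measure.pi fun _ : ι => Measure.pi μ).map (fun x => x i j) = μ j :=
    ((measurePreserving_eval μ j).comp hrow).map_eq
  simp only [hentry]
  exact hrow.map_eq

variable [DecidableEq κ] {s C η k K : ℝ} {w : ι → ℝ}

theorem expMoment_quadraticForm_vecMul_le (hC : 0 ≤ C) (hη : 0 ≤ η) (hsη : 4 * |s| * C * η ≤ 1)
    (hK : k + 4 * C * η * |s * K| ≤ K) (μ : κ → Measure ℝ) [∀ j, IsProbabilityMeasure (μ j)]
    (hμ : ∀ j, HasQuadraticMGFBound (μ j) id s η k C) {A : Matrix κ κ ℝ} (hA : 0 ≤ A)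
    (hAη : A ≤ η • 1) (hw : w ⬝ᵥ w = 1) :
    expMoment (Measure.pi fun _ : ι => Measure.pi μ)
        (fun x => s * ((w ᵥ* Matrix.of x) ⬝ᵥ A *ᵥ (w ᵥ* Matrix.of x))) ≤
      ENNReal.ofReal (Real.exp (K * A.trace)) := by
  classical
  have hentry (q : ι × κ) :
      (Measure.pi fun _ : ι => Measure.pi μ).map (fun x => x q.1 q.2) = μ q.2 :=
    ((measurePreserving_eval μ q.2).comp
      (measurePreserving_eval (fun _ : ι => Measure.pi μ) q.1)).map_eq
  have hmeas (q : ι × κ) :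
      AEMeasurable (fun x : ι → κ → ℝ => x q.1 q.2) (Measure.pi fun _ => Measure.pi μ) :=
    (by fun_prop : Measurable fun x : ι → κ → ℝ => x q.1 q.2).aemeasurable
  have htrace : (vecMulVec w w ⊗ₖ A).trace = A.trace := by
    rw [trace_kronecker, trace_vecMulVec, hw, one_mul]
  simp only [← vec_transpose_dotProduct_kronecker_mulVec, ← htrace]
  refine expMoment_quadraticForm_le (iIndepFun_pi_eval_eval μ) hmeas hC hsη hK (fun q => ?_)
    ((posSemidef_vecMulVec_self_star w).kronecker hA.posSemidef).nonneg
    (vecMulVec_kronecker_le hw hη hAη)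
  rw [← hasQuadraticMGFBound_map_iff (hmeas q), hentry]
  exact hμ q.2

variable {Ω₀ Ω : Type*} [MeasurableSpace Ω₀] [MeasurableSpace Ω] {Q : Measure Ω₀} {P : Measure Ω}

theorem identDistrib_pi_of_iIndepFun {E Ω' : Type*} [MeasurableSpace E] [MeasurableSpace Ω']
    {ν : Measure Ω'} [IsProbabilityMeasure ν] {Z : ι → Ω → E} {g : Ω' → E} (hg : Measurable g)
    (hZ : iIndepFun Z P) (h : ∀ i, IdentDistrib (Z i) g P ν) :
    IdentDistrib (fun ω i => Z i ω) (fun x i => g (x i)) P (Measure.pi fun _ : ι => ν) := by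
  refine IdentDistrib.pi (fun i => (h i).trans ?_) hZ (iIndepFun_pi fun _ => hg.aemeasurable)
  have heval := measurePreserving_eval (fun _ : ι => ν) i
  have hid : IdentDistrib id (Function.eval i) ν (Measure.pi fun _ : ι => ν) :=
    ⟨aemeasurable_id, heval.aemeasurable, by rw [heval.map_eq, Measure.map_id]⟩
  exact hid.comp hg

theorem expMoment_norm_sum_smul_sq_le {m : Type*} [Fintype m] {B : Matrix m κ ℝ}
    {X' : κ → Ω₀ → ℝ} {X : Ω₀ → EuclideanSpace ℝ m} {Xs : ι → Ω → EuclideanSpace ℝ m} {c : ℝ}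
    (hC : 0 ≤ C) (hη : 0 ≤ η) (hsη : 4 * |s| * C * η ≤ 1) (hK : k + 4 * C * η * |s * K| ≤ K)
    (hX'i : iIndepFun X' Q) (hX'm : ∀ j, AEMeasurable (X' j) Q)
    (hX' : ∀ j, HasQuadraticMGFBound Q (X' j) s η k C)
    (hX : ∀ᵐ ω ∂Q, X ω = WithLp.toLp 2 (B *ᵥ fun j => X' j ω)) (hXs : iIndepFun Xs P)
    (hXsX : ∀ i, IdentDistrib (Xs i) X P Q) (hc : 0 ≤ c) (hcη : c • (Bᵀ * B) ≤ η • 1)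
    (hw : w ⬝ᵥ w = 1) :
    expMoment P (fun ω => s * (c * ‖∑ i, w i • Xs i ω‖ ^ 2)) ≤
      ENNReal.ofReal (Real.exp (K * (c * (Bᵀ * B).trace))) := by
  have : IsProbabilityMeasure Q := hX'i.isProbabilityMeasure
  have (j : κ) : IsProbabilityMeasure (Q.map (X' j)) := Measure.isProbabilityMeasure_map (hX'm j)
  have hg : Measurable fun z : κ → ℝ => WithLp.toLp 2 (B *ᵥ z) :=
    Continuous.measurable (by fun_prop)
  have hlaw (i : ι) : IdentDistrib (Xs i) (fun z => WithLp.toLp 2 (B *ᵥ z)) P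
      (Measure.pi fun j => Q.map (X' j)) := by
    refine (hXsX i).trans ⟨(hXsX i).aemeasurable_snd, hg.aemeasurable, ?_⟩
    rw [Measure.map_congr hX, ← (iIndepFun_iff_map_fun_eq_pi_map hX'm).mp hX'i,
      AEMeasurable.map_map_of_aemeasurable hg.aemeasurable (by fun_prop)]
    rfl
  have hnorm (x : ι → κ → ℝ) : c * ‖∑ i, w i • WithLp.toLp 2 (B *ᵥ x i)‖ ^ 2 =
      (w ᵥ* Matrix.of x) ⬝ᵥ (c • (Bᵀ * B)) *ᵥ (w ᵥ* Matrix.of x) := by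
    have hsum : ∑ i, w i • WithLp.toLp 2 (B *ᵥ x i) = WithLp.toLp 2 (B *ᵥ (w ᵥ* Matrix.of x)) := by
      rw [vecMul_eq_sum, mulVec_sum, WithLp.toLp_sum]
      simp only [mulVec_smul, WithLp.toLp_smul]
      rfl
    rw [hsum, ← real_inner_self_eq_norm_sq, EuclideanSpace.inner_toLp_toLp, star_trivial,
      smul_mulVec, dotProduct_smul, smul_eq_mul, ← mulVec_mulVec, dotProduct_mulVec _ Bᵀ,
      vecMul_transpose]
  have hnonneg : 0 ≤ c • (Bᵀ * B) := smul_nonneg hc (posSemidef_conjTranspose_mul_self B).nonneg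
  rw [expMoment_congr_identDistrib (identDistrib_pi_of_iIndepFun hg hXs hlaw)
    (h := fun x => s * (c * ‖∑ i, w i • x i‖ ^ 2)) (by fun_prop)]
  simp only [hnorm, ← smul_eq_mul (a := c), ← trace_smul]
  exact expMoment_quadraticForm_vecMul_le hC hη hsη hK _
    (fun j => (hasQuadraticMGFBound_map_iff (hX'm j)).mpr (hX' j)) hnonneg hcη hw

end LinearCombination

/-! ### Nets of the unit sphere -/

section Net

open Metric Module
open scoped NNReal

variable {E F : Type*} [NormedAddCommGroup E] [NormedSpace ℝ E] [NormedAddCommGroup F]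
  [NormedSpace ℝ F]

theorem one_sub_mul_opNorm_le_of_isCover_sphere (L : E →L[ℝ] F) {ε : ℝ≥0} {s : Set E} {a : ℝ}
    (hs : IsCover ε (sphere 0 1) s) (ha : 0 ≤ a) (hL : ∀ c ∈ s, ‖L c‖ ≤ a) :
    (1 - ε) * ‖L‖ ≤ a := by
  suffices ‖L‖ ≤ a + ε * ‖L‖ by linarith
  refine L.opNorm_le_of_unit_norm (by positivity) fun x hx => ?_
  obtain ⟨c, hc, hxc⟩ := hs (mem_sphere_zero_iff_norm.mpr hx)
  replace hxc : ‖x - c‖ ≤ ε := by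
    rwa [← dist_eq_norm, ← edist_le_ofReal ε.coe_nonneg, ENNReal.ofReal_coe_nnreal]
  calc ‖L x‖ = ‖L c + L (x - c)‖ := by rw [← map_add, add_sub_cancel]
    _ ≤ ‖L c‖ + ‖L‖ * ‖x - c‖ := (norm_add_le _ _).trans (by gcongr; exact L.le_opNorm _)
    _ ≤ a + ‖L‖ * ε := by gcongr; exact hL c hc
    _ = a + ε * ‖L‖ := by rw [mul_comm]

theorem sub_mul_norm_le_of_isCover_sphere (L : E →L[ℝ] F) {ε : ℝ≥0} {s : Set E} {b : ℝ}
    (hs : IsCover ε (sphere 0 1) s) (hL : ∀ c ∈ s, b ≤ ‖L c‖) (x : E) :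
    (b - ε * ‖L‖) * ‖x‖ ≤ ‖L x‖ := by
  rcases eq_or_ne x 0 with rfl | hx
  · simp
  set u := ‖x‖⁻¹ • x
  have hu : ‖u‖ = 1 := norm_smul_inv_norm (𝕜 := ℝ) hx
  obtain ⟨c, hc, huc⟩ := hs (mem_sphere_zero_iff_norm.mpr hu)
  replace huc : ‖u - c‖ ≤ ε := by
    rwa [← dist_eq_norm, ← edist_le_ofReal ε.coe_nonneg, ENNReal.ofReal_coe_nnreal]
  have hLu : b - ε * ‖L‖ ≤ ‖L u‖ := by
    have : ‖L c‖ ≤ ‖L u‖ + ‖L‖ * ε :=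
      calc ‖L c‖ = ‖L u - L (u - c)‖ := by rw [← map_sub, sub_sub_cancel]
        _ ≤ ‖L u‖ + ‖L‖ * ‖u - c‖ := (norm_sub_le _ _).trans (by gcongr; exact L.le_opNorm _)
        _ ≤ ‖L u‖ + ‖L‖ * ε := by gcongr
    linarith [hL c hc]
  calc (b - ε * ‖L‖) * ‖x‖ ≤ ‖L u‖ * ‖x‖ := by gcongr
    _ = ‖L x‖ := by
        rw [map_smul, norm_smul, norm_inv, norm_norm, mul_comm,
          mul_inv_cancel_left₀ (norm_ne_zero_iff.mpr hx)]

variable [FiniteDimensional ℝ E] {ε : ℝ≥0}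

theorem card_le_of_isSeparated_of_subset_closedBall (hε : 0 < ε) {s : Finset E}
    (hs : (s : Set E) ⊆ closedBall 0 1) (hsep : IsSeparated ε (s : Set E)) :
    (s.card : ℝ) ≤ (1 + 2 / ε) ^ finrank ℝ E := by
  borelize E
  let μ : Measure E := Measure.addHaar
  have hε' : (0 : ℝ) < ε := hε
  have hdisj : Set.PairwiseDisjoint (s : Set E) fun c => ball c (ε / 2 : ℝ) := by
    refine fun c hc d hd hcd => ball_disjoint_ball ?_
    have : (ε : ℝ≥0∞) < edist c d := hsep hc hd hcd
    rw [edist_nndist, ENNReal.coe_lt_coe, ← NNReal.coe_lt_coe, coe_nndist] at this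
    linarith
  have hsub : ⋃ c ∈ s, ball c (ε / 2 : ℝ) ⊆ ball 0 (1 + ε / 2) :=
    Set.iUnion₂_subset fun c hc => ball_subset_ball' (by
      linarith [mem_closedBall.mp (hs hc)])
  have hball_vol (c : E) {r : ℝ} (hr : 0 < r) :
      μ.real (ball c r) = r ^ finrank ℝ E * μ.real (ball 0 1) := by
    rw [measureReal_def, μ.addHaar_ball_of_pos c hr, ENNReal.toReal_mul,
      ENNReal.toReal_ofReal (by positivity), measureReal_def]
  have hvol : (s.card : ℝ) * (ε / 2 : ℝ) ^ finrank ℝ E * μ.real (ball 0 1) ≤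
      (1 + ε / 2 : ℝ) ^ finrank ℝ E * μ.real (ball 0 1) :=
    calc _ = μ.real (⋃ c ∈ s, ball c (ε / 2 : ℝ)) := by
          rw [measureReal_biUnion_finset hdisj (fun c _ => measurableSet_ball)
            fun c _ => measure_ball_lt_top.ne]
          simp only [hball_vol _ (half_pos hε'), Finset.sum_const, nsmul_eq_mul,
            mul_assoc]
      _ ≤ μ.real (ball 0 (1 + ε / 2)) := measureReal_mono hsub measure_ball_lt_top.ne
      _ = _ := hball_vol 0 (by positivity)
  have hball : 0 < μ.real (ball 0 1) :=
    ENNReal.toReal_pos (measure_ball_pos _ _ zero_lt_one).ne' measure_ball_lt_top.ne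
  calc (s.card : ℝ) ≤ (1 + ε / 2 : ℝ) ^ finrank ℝ E / (ε / 2) ^ finrank ℝ E :=
        (le_div_iff₀ (by positivity)).mpr (le_of_mul_le_mul_right hvol hball)
    _ = (1 + 2 / ε) ^ finrank ℝ E := by
        rw [← div_pow]
        congr 1
        field_simp
        ring

theorem packingNumber_le_of_subset_closedBall (hε : 0 < ε) {A : Set E} (hA : A ⊆ closedBall 0 1) :
    packingNumber ε A ≤ (⌊(1 + 2 / ε : ℝ) ^ finrank ℝ E⌋₊ : ℕ∞) := by
  refine iSup₂_le fun C hCA => iSup_le fun hC => ?_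
  by_contra! hcard
  obtain ⟨D, hDC, hD⟩ := Set.exists_subset_encard_eq (Order.add_one_le_of_lt hcard)
  have hDfin : D.Finite := Set.finite_of_encard_eq_coe hD
  have hle := card_le_of_isSeparated_of_subset_closedBall (s := hDfin.toFinset) hε
    (by simpa using (hDC.trans hCA).trans hA) (by simpa using hC.subset hDC)
  have hDcard : hDfin.toFinset.card = ⌊(1 + 2 / ε : ℝ) ^ finrank ℝ E⌋₊ + 1 := by
    rw [hDfin.encard_eq_coe_toFinset_card] at hD
    exact_mod_cast hD
  exact (Nat.le_floor hle).not_gt (by omega)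

theorem exists_finset_isCover_sphere (hε : 0 < ε) :
    ∃ s : Finset E, (∀ c ∈ s, ‖c‖ = 1) ∧ IsCover ε (sphere (0 : E) 1) s ∧
      (s.card : ℝ) ≤ (1 + 2 / ε) ^ finrank ℝ E := by
  have hle := (coveringNumber_le_packingNumber ε (sphere (0 : E) 1)).trans
    (packingNumber_le_of_subset_closedBall hε sphere_subset_closedBall)
  have hfin : coveringNumber ε (sphere (0 : E) 1) ≠ ⊤ :=
    (hle.trans_lt (ENat.natCast_lt_top _)).ne
  refine ⟨finite_minimalCover.toFinset, fun c hc => ?_,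
    by simpa using isCover_minimalCover hfin, ?_⟩
  · exact mem_sphere_zero_iff_norm.mp (minimalCover_subset (by simpa using hc))
  · rw [← encard_minimalCover hfin, finite_minimalCover.encard_eq_coe_toFinset_card,
      Nat.cast_le] at hle
    exact (Nat.cast_le.mpr hle).trans (Nat.floor_le (by positivity))

end Net

/-! ### Short solutions of underdetermined systems -/

theorem exists_apply_eq_and_mul_norm_le {E F : Type*} [NormedAddCommGroup E]
    [InnerProductSpace ℝ E] [FiniteDimensional ℝ E] [NormedAddCommGroup F] [InnerProductSpace ℝ F]
    [FiniteDimensional ℝ F] (L : E →ₗ[ℝ] F) {s : ℝ} (hs : 0 < s)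
    (h : ∀ x, s * ‖x‖ ≤ ‖L.adjoint x‖) (b : F) : ∃ α, L α = b ∧ s * ‖α‖ ≤ ‖b‖ := by
  have hinj : Function.Injective (L ∘ₗ L.adjoint) := by
    refine (injective_iff_map_eq_zero _).mpr fun x hx => ?_
    have hzero : ‖L.adjoint x‖ ^ 2 = 0 := by
      rw [← real_inner_self_eq_norm_sq, LinearMap.adjoint_inner_left, ← LinearMap.comp_apply, hx,
        inner_zero_right]
    have hx0 := h x
    rw [(pow_eq_zero_iff two_ne_zero).mp hzero] at hx0
    exact norm_le_zero_iff.mp (nonpos_of_mul_nonpos_right hx0 hs)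
  obtain ⟨x, hx⟩ := LinearMap.injective_iff_surjective.mp hinj b
  refine ⟨L.adjoint x, hx, ?_⟩
  have hnorm : ‖L.adjoint x‖ ^ 2 ≤ ‖x‖ * ‖b‖ := by
    rw [← real_inner_self_eq_norm_sq, LinearMap.adjoint_inner_left, ← LinearMap.comp_apply, hx]
    exact real_inner_le_norm _ _
  rcases (norm_nonneg (L.adjoint x)).eq_or_lt with h0 | h0
  · simp [← h0]
  · refine le_of_mul_le_mul_right ?_ h0
    calc s * ‖L.adjoint x‖ * ‖L.adjoint x‖ = s * ‖L.adjoint x‖ ^ 2 := by ring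
      _ ≤ s * (‖x‖ * ‖b‖) := by gcongr
      _ = s * ‖x‖ * ‖b‖ := by ring
      _ ≤ ‖L.adjoint x‖ * ‖b‖ := by gcongr; exact h x
      _ = ‖b‖ * ‖L.adjoint x‖ := mul_comm _ _

section MinNorm

open Matrix

variable {n p : ℕ} {A : Matrix (Fin n) (Fin p) ℝ} {b : EuclideanSpace ℝ (Fin n)}
  {α β : EuclideanSpace ℝ (Fin p)} {s : ℝ}

theorem IsMinNormLeastSquares.norm_le_of_apply_eq (hα : IsMinNormLeastSquares A b α)
    (hβ : toEuclideanLin A β = b) : ‖α‖ ≤ ‖β‖ :=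
  hα.2 β fun u => by rw [hβ, sub_self, norm_zero]; exact norm_nonneg _

theorem mul_norm_minNormEstimator_le (hs : 0 < s)
    (h : ∀ x, s * ‖x‖ ≤ ‖toEuclideanLin Aᵀ x‖) : s * ‖minNormEstimator A b‖ ≤ ‖b‖ := by
  rw [← conjTranspose_eq_transpose_of_trivial, toEuclideanLin_conjTranspose_eq_adjoint] at h
  obtain ⟨β, hβ, hβb⟩ := exists_apply_eq_and_mul_norm_le _ hs h b
  have hmin : IsMinNormLeastSquares A b (minNormEstimator A b) :=
    (existsUnique_isMinNormLeastSquares A b).choose_spec.1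
  exact (by gcongr; exact hmin.norm_le_of_apply_eq hβ : _ ≤ s * ‖β‖).trans hβb

variable {Ω : Type*} {Xs : Fin n → Ω → EuclideanSpace ℝ (Fin p)} {ys : Fin n → Ω → ℝ} {ω : Ω}

theorem mul_norm_sampleEstimator_le (hs : 0 < s)
    (h : ∀ x : EuclideanSpace ℝ (Fin n), s * ‖x‖ ≤ ‖∑ i, x i • Xs i ω‖) :
    s * ‖sampleEstimator Xs ys ω‖ ≤ ‖WithLp.toLp 2 fun i => ys i ω‖ := by
  refine mul_norm_minNormEstimator_le hs fun x => (h x).trans_eq (congrArg norm ?_)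
  ext j
  simp [toLpLin_apply, mulVec, dotProduct, mul_comm]

end MinNorm

/-! ### Moments and covariance of sub-Gaussian vectors -/

section Moments

variable {Ω : Type*} [MeasurableSpace Ω] {Q : Measure Ω} {M : ℝ} {U : Ω → ℝ}

theorem IsStdSubGaussian.expMoment_sq_div_sq_le_two (hU : IsStdSubGaussian Q M U) (hM : 0 < M) :
    expMoment Q (fun ω => U ω ^ 2 / M ^ 2) ≤ 2 :=
  NullRisk.expMoment_sq_div_sq_le_two hU.aemeasurable hM hU.psi2Norm_le

theorem IsStdSubGaussian.integral_sq_eq_one (hU : IsStdSubGaussian Q M U) :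
    ∫ ω, U ω ^ 2 ∂Q = 1 := by
  rw [← hU.variance_eq_one, variance_of_integral_eq_zero hU.aemeasurable hU.mean_eq_zero]

theorem IsStdSubGaussian.memLp_two (hU : IsStdSubGaussian Q M U) (hM : 0 < M) : MemLp U 2 Q :=
  (memLp_two_iff_integrable_sq hU.aemeasurable.aestronglyMeasurable).mpr <|
    integrable_sq_of_expMoment_lt_top hU.aemeasurable hM
      ((hU.expMoment_sq_div_sq_le_two hM).trans_lt ENNReal.ofNat_lt_top)

end Moments

section Covariance

open Matrix

variable {Ω : Type*} [MeasurableSpace Ω] {Q : Measure Ω} {p : ℕ} {X : Ω → EuclideanSpace ℝ (Fin p)}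

theorem dotProduct_mulVec_le_opNorm (S : Matrix (Fin p) (Fin p) ℝ) (x : EuclideanSpace ℝ (Fin p)) :
    x.ofLp ⬝ᵥ S *ᵥ x.ofLp ≤ ‖toEuclideanCLM (𝕜 := ℝ) S‖ * ‖x‖ ^ 2 :=
  calc x.ofLp ⬝ᵥ S *ᵥ x.ofLp = inner ℝ x (toEuclideanCLM (𝕜 := ℝ) S x) := by
        rw [EuclideanSpace.inner_eq_star_dotProduct, star_trivial, ofLp_toEuclideanCLM,
          dotProduct_comm]
    _ ≤ ‖x‖ * (‖toEuclideanCLM (𝕜 := ℝ) S‖ * ‖x‖) :=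
        (real_inner_le_norm _ _).trans (by gcongr; exact ContinuousLinearMap.le_opNorm _ _)
    _ = _ := by ring

theorem le_opNorm_smul_one {S : Matrix (Fin p) (Fin p) ℝ} (hS : S.IsHermitian) :
    S ≤ ‖toEuclideanCLM (𝕜 := ℝ) S‖ • 1 := by
  rw [Matrix.le_iff]
  refine .of_dotProduct_mulVec_nonneg ((isHermitian_one.smul (star_trivial _)).sub hS) fun x => ?_
  have h := dotProduct_mulVec_le_opNorm S (WithLp.toLp 2 x)
  rw [EuclideanSpace.real_norm_sq_eq] at h
  rw [star_trivial, sub_mulVec, smul_mulVec, one_mulVec, dotProduct_sub, dotProduct_smul,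
    sub_nonneg]
  simpa only [dotProduct, ← sq, smul_eq_mul] using h

theorem covMatrix_isHermitian : (covMatrix Q X).IsHermitian := by
  ext i j
  simp [covMatrix, covariance_comm]

theorem variance_inner_eq [IsFiniteMeasure Q] (hX : MemLp X 2 Q) (α : EuclideanSpace ℝ (Fin p)) :
    Var[fun ω => inner ℝ (X ω) α; Q] = α.ofLp ⬝ᵥ covMatrix Q X *ᵥ α.ofLp := by
  have hXα (i : Fin p) : MemLp (fun ω => α i * X ω i) 2 Q := (hX.eval_piLp i).const_mul _
  rw [← covariance_self (hX.inner_const α).aemeasurable]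
  simp only [PiLp.inner_apply, RCLike.inner_apply, conj_trivial]
  rw [covariance_fun_sum_fun_sum hXα hXα]
  simp only [covariance_const_mul_left, covariance_const_mul_right, dotProduct, mulVec,
    Finset.mul_sum, covMatrix, of_apply]
  exact Finset.sum_congr rfl fun i _ => Finset.sum_congr rfl fun j _ => by ring

theorem covMatrix_posSemidef [IsFiniteMeasure Q] (hX : MemLp X 2 Q) :
    (covMatrix Q X).PosSemidef := by
  refine .of_dotProduct_mulVec_nonneg covMatrix_isHermitian fun x => ?_
  rw [star_trivial]
  exact (variance_nonneg _ _).trans_eq (variance_inner_eq hX (WithLp.toLp 2 x))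

theorem integral_inner_sq_le [IsFiniteMeasure Q] (hX : MemLp X 2 Q) (hmean : ∫ ω, X ω ∂Q = 0)
    (α : EuclideanSpace ℝ (Fin p)) :
    ∫ ω, inner ℝ (X ω) α ^ 2 ∂Q ≤ ‖toEuclideanCLM (𝕜 := ℝ) (covMatrix Q X)‖ * ‖α‖ ^ 2 := by
  have hinner : ∫ ω, inner ℝ (X ω) α ∂Q = 0 := by
    simp only [real_inner_comm α]
    rw [integral_inner (hX.integrable one_le_two), hmean, inner_zero_right]
  rw [← variance_of_integral_eq_zero (hX.inner_const α).aemeasurable hinner, variance_inner_eq hX]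
  exact dotProduct_mulVec_le_opNorm _ _

end Covariance

section Risk

variable {Ω : Type*} [MeasurableSpace Ω] {Q : Measure Ω} {f g : Ω → ℝ} {a : ℝ} {p : ℕ}
  {X : Ω → EuclideanSpace ℝ (Fin p)} {y : Ω → ℝ}

theorem abs_integral_sub_sq_sub_le (hf : MemLp f 2 Q) (hg : MemLp g 2 Q) (ha : 0 < a)
    (h : ∫ ω, f ω ^ 2 ∂Q ≤ a ^ 2 * ∫ ω, g ω ^ 2 ∂Q) :
    |∫ ω, (f ω - g ω) ^ 2 ∂Q - ∫ ω, g ω ^ 2 ∂Q| ≤ (a ^ 2 + 2 * a) * ∫ ω, g ω ^ 2 ∂Q := by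
  have hf2 := hf.integrable_sq
  have hg2 := hg.integrable_sq
  have hfg2 : Integrable (fun ω => (f ω - g ω) ^ 2) Q := (hf.sub hg).integrable_sq
  have young (ω : Ω) :
      |(f ω - g ω) ^ 2 - g ω ^ 2| ≤ (1 + 1 / a) * f ω ^ 2 + a * g ω ^ 2 := by
    have upper : (1 + 1 / a) * f ω ^ 2 + a * g ω ^ 2 - ((f ω - g ω) ^ 2 - g ω ^ 2) =
        (f ω + a * g ω) ^ 2 / a := by field_simp; ring
    have lower : (1 + 1 / a) * f ω ^ 2 + a * g ω ^ 2 + ((f ω - g ω) ^ 2 - g ω ^ 2) =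
        2 * f ω ^ 2 + (f ω - a * g ω) ^ 2 / a := by field_simp; ring
    have : 0 ≤ (f ω + a * g ω) ^ 2 / a := by positivity
    have : 0 ≤ 2 * f ω ^ 2 + (f ω - a * g ω) ^ 2 / a := by positivity
    rw [abs_le]
    constructor <;> linarith
  calc |∫ ω, (f ω - g ω) ^ 2 ∂Q - ∫ ω, g ω ^ 2 ∂Q|
      ≤ ∫ ω, |(f ω - g ω) ^ 2 - g ω ^ 2| ∂Q := by
        rw [← integral_sub hfg2 hg2]
        exact abs_integral_le_integral_abs
    _ ≤ ∫ ω, ((1 + 1 / a) * f ω ^ 2 + a * g ω ^ 2) ∂Q :=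
        integral_mono (hfg2.sub hg2).abs ((hf2.const_mul _).add (hg2.const_mul _)) young
    _ = (1 + 1 / a) * ∫ ω, f ω ^ 2 ∂Q + a * ∫ ω, g ω ^ 2 ∂Q := by
        rw [integral_add (hf2.const_mul _) (hg2.const_mul _), integral_const_mul,
          integral_const_mul]
    _ ≤ (1 + 1 / a) * (a ^ 2 * ∫ ω, g ω ^ 2 ∂Q) + a * ∫ ω, g ω ^ 2 ∂Q := by gcongr
    _ = (a ^ 2 + 2 * a) * ∫ ω, g ω ^ 2 ∂Q := by field_simp; ring

theorem abs_risk_div_risk_zero_sub_one_le [IsFiniteMeasure Q] (hX : MemLp X 2 Q)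
    (hmean : ∫ ω, X ω ∂Q = 0) (hyL : MemLp y 2 Q) (hy : 0 < ∫ ω, y ω ^ 2 ∂Q)
    {α : EuclideanSpace ℝ (Fin p)} (ha : 0 < a)
    (hα : ‖Matrix.toEuclideanCLM (𝕜 := ℝ) (covMatrix Q X)‖ * ‖α‖ ^ 2 ≤ a ^ 2 * ∫ ω, y ω ^ 2 ∂Q) :
    |risk Q X y α / risk Q X y 0 - 1| ≤ a ^ 2 + 2 * a := by
  have hzero : risk Q X y 0 = ∫ ω, y ω ^ 2 ∂Q := by simp [risk]
  rw [hzero, div_sub_one hy.ne', abs_div, abs_of_pos hy, div_le_iff₀ hy]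
  exact abs_integral_sub_sq_sub_le (hX.inner_const α) hyL ha
    ((integral_inner_sq_le hX hmean α).trans hα)

end Risk

section SubGaussianPair

variable {Ω : Type*} [MeasurableSpace Ω] {Q : Measure Ω} {M : ℝ} {p : ℕ}
  {X : Ω → EuclideanSpace ℝ (Fin p)} {y : Ω → ℝ}

theorem SubGaussianPair.isProbabilityMeasure (h : SubGaussianPair Q M X y) :
    IsProbabilityMeasure Q :=
  h.choose_spec.choose_spec.1.isProbabilityMeasure

theorem SubGaussianPair.memLp_features (h : SubGaussianPair Q M X y) (hM : 0 < M) :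
    MemLp X 2 Q := by
  obtain ⟨X', -, -, hX', -, hX, -⟩ := h
  refine (MemLp.of_eval_piLp fun i => ?_).ae_eq (EventuallyEq.symm hX)
  exact memLp_finsetSum Finset.univ fun j _ => ((hX' j).memLp_two hM).const_mul _

theorem SubGaussianPair.integral_features_eq_zero (h : SubGaussianPair Q M X y) (hM : 0 < M) :
    ∫ ω, X ω ∂Q = 0 := by
  have hXL := h.memLp_features hM
  have := h.isProbabilityMeasure
  obtain ⟨X', -, -, hX', -, hX, -⟩ := h
  ext i
  rw [eval_integral_piLp fun i => (hXL.eval_piLp i).integrable one_le_two]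
  calc ∫ ω, X ω i ∂Q = ∫ ω, ∑ j, CFC.sqrt (covMatrix Q X) i j * X' j ω ∂Q :=
        integral_congr_ae (hX.mono fun ω hω => by simp only [hω]; rfl)
    _ = 0 := by
        rw [integral_finsetSum _ fun j _ =>
          (((hX' j).memLp_two hM).integrable one_le_two).const_mul _]
        simp [integral_const_mul, (hX' _).mean_eq_zero]

theorem SubGaussianPair.memLp_response (h : SubGaussianPair Q M X y) (hM : 0 < M) :
    MemLp y 2 Q := by
  obtain ⟨-, y', -, -, hy', -, hy⟩ := h
  exact ((hy'.memLp_two hM).const_mul _).ae_eq (EventuallyEq.symm hy)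

theorem SubGaussianPair.expMoment_response_le (h : SubGaussianPair Q M X y) (hM : 0 < M)
    (hy : 0 < ∫ ω, y ω ^ 2 ∂Q) :
    expMoment Q (fun ω => y ω ^ 2 / (M * √(∫ ω', y ω' ^ 2 ∂Q)) ^ 2) ≤ 2 := by
  obtain ⟨-, y', -, -, hy', -, hyy'⟩ := h
  refine (expMoment_congr_ae ?_).trans_le (hy'.expMoment_sq_div_sq_le_two hM)
  filter_upwards [hyy'] with ω hω
  rw [hω, mul_comm M, mul_pow, mul_pow, mul_div_mul_left _ _ (by positivity)]

end SubGaussianPair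

/-! ### Concentration -/

section SumOfSquares

variable {ι Ω : Type*} [Fintype ι] [MeasurableSpace Ω] {P : Measure Ω}

theorem expMoment_sum {f : ι → Ω → ℝ} (hf : iIndepFun f P) (hfm : ∀ i, AEMeasurable (f i) P) :
    expMoment P (fun ω => ∑ i, f i ω) = ∏ i, expMoment P (f i) := by
  let g (i : ι) : Ω → ℝ := (hfm i).mk (f i)
  have hfg (i : ι) : f i =ᵐ[P] g i := (hfm i).ae_eq_mk
  have hgm (i : ι) : Measurable (g i) := (hfm i).measurable_mk
  have hsum : (fun ω => ∑ i, f i ω) =ᵐ[P] fun ω => ∑ i, g i ω := by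
    filter_upwards [ae_all_iff.mpr hfg] with ω hω
    simp only [hω]
  calc expMoment P (fun ω => ∑ i, f i ω)
      = ∫⁻ ω, ∏ i, ENNReal.ofReal (Real.exp (g i ω)) ∂P := by
        rw [expMoment_congr_ae hsum]
        refine lintegral_congr fun ω => ?_
        rw [Real.exp_sum, ENNReal.ofReal_prod_of_nonneg fun _ _ => Real.exp_nonneg _]
    _ = ∏ i, expMoment P (g i) :=
        lintegral_prod_eq_prod_lintegral_of_indepFun _ _
          ((hf.congr hfg).comp (fun _ t => ENNReal.ofReal (Real.exp t)) fun _ => by fun_prop)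
          fun i => (hgm i).exp.ennreal_ofReal
    _ = ∏ i, expMoment P (f i) :=
        Finset.prod_congr rfl fun i _ => (expMoment_congr_ae (hfg i)).symm

theorem measureReal_two_mul_sq_mul_card_le_sum_sq_le {Z : ι → Ω → ℝ} {T : ℝ} (hZ : iIndepFun Z P)
    (hZm : ∀ i, AEMeasurable (Z i) P) (hT : 0 < T)
    (h : ∀ i, expMoment P (fun ω => Z i ω ^ 2 / T ^ 2) ≤ 2) :
    P.real {ω | 2 * T ^ 2 * Fintype.card ι ≤ ∑ i, Z i ω ^ 2} ≤ Real.exp (-Fintype.card ι) := by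
  have two_le_exp : (2 : ℝ≥0∞) ≤ ENNReal.ofReal (Real.exp 1) := by
    rw [← ENNReal.ofReal_ofNat]
    exact ENNReal.ofReal_le_ofReal (by linarith [Real.add_one_le_exp 1])
  have hexp : expMoment P (fun ω => ∑ i, Z i ω ^ 2 / T ^ 2) ≤
      ENNReal.ofReal (Real.exp (Fintype.card ι)) :=
    calc expMoment P (fun ω => ∑ i, Z i ω ^ 2 / T ^ 2)
        = ∏ i, expMoment P (fun ω => Z i ω ^ 2 / T ^ 2) :=
          expMoment_sum (hZ.comp (fun _ t => t ^ 2 / T ^ 2) fun _ => by fun_prop)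
            fun i => by fun_prop
      _ ≤ ∏ _i : ι, ENNReal.ofReal (Real.exp 1) :=
          Finset.prod_le_prod' fun i _ => (h i).trans two_le_exp
      _ = ENNReal.ofReal (Real.exp (Fintype.card ι)) := by
          rw [Finset.prod_const, Finset.card_univ, ← ENNReal.ofReal_pow (Real.exp_nonneg 1),
            Real.exp_one_pow]
  have markov := measureReal_le_of_expMoment_le (by fun_prop) hexp (2 * Fintype.card ι)
  rw [show (Fintype.card ι - 2 * Fintype.card ι : ℝ) = -Fintype.card ι by ring] at markov
  simpa only [← Finset.sum_div, le_div_iff₀ (pow_pos hT 2), mul_right_comm] using markov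

end SumOfSquares

/-- A range `[0, mgfRadius M]` of exponents for which the quadratic moment generating functions of
the coordinates, and hence of the quadratic forms in them, are controlled when the coordinates have
`ψ₂`-norm at most `M`. -/
noncomputable def mgfRadius (M : ℝ) : ℝ :=
  1 / (16 * (M ^ 2 + M ^ 4))

section MGFRadius

variable {M : ℝ} (hM : 0 < M)
include hM

theorem mgfRadius_pos : 0 < mgfRadius M := by
  unfold mgfRadius
  positivity

theorem mgfRadius_mul_sq_add_pow_four : mgfRadius M * (M ^ 2 + M ^ 4) = 1 / 16 := by
  unfold mgfRadius
  field_simp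

theorem mgfRadius_mul_sq_le : mgfRadius M * M ^ 2 ≤ 1 / 16 := by
  rw [← mgfRadius_mul_sq_add_pow_four hM]
  gcongr
  exacts [(mgfRadius_pos hM).le, le_add_of_nonneg_right (by positivity)]

theorem mgfRadius_mul_pow_four_le : mgfRadius M * M ^ 4 ≤ 1 / 16 := by
  rw [← mgfRadius_mul_sq_add_pow_four hM]
  gcongr
  exacts [(mgfRadius_pos hM).le, le_add_of_nonneg_left (by positivity)]

end MGFRadius

section EffectiveRank

variable {p : ℕ} {S : Matrix (Fin p) (Fin p) ℝ}

theorem opNorm_pos_of_effectiveRank_pos (h : 0 < effectiveRank S) :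
    0 < ‖Matrix.toEuclideanCLM (𝕜 := ℝ) S‖ := by
  refine (norm_nonneg _).lt_of_ne' fun h0 => ?_
  rw [effectiveRank, h0, div_zero] at h
  exact h.false

theorem trace_pos_of_effectiveRank_pos (h : 0 < effectiveRank S) : 0 < S.trace :=
  (div_pos_iff_of_pos_right (opNorm_pos_of_effectiveRank_pos h)).mp h

end EffectiveRank

section Sample

open Matrix

variable {Ω₀ Ω : Type*} [MeasurableSpace Ω₀] [MeasurableSpace Ω] {n p : ℕ} {Q : Measure Ω₀}
  {P : Measure Ω} {X : Ω₀ → EuclideanSpace ℝ (Fin p)} {y : Ω₀ → ℝ}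
  {Xs : Fin n → Ω → EuclideanSpace ℝ (Fin p)} {ys : Fin n → Ω → ℝ} {M : ℝ}

theorem IsIIDSample.identDistrib_features (hS : IsIIDSample Q X y P Xs ys) (i : Fin n) :
    IdentDistrib (Xs i) X P Q :=
  (hS.identDistrib i).comp measurable_fst

theorem IsIIDSample.identDistrib_response (hS : IsIIDSample Q X y P Xs ys) (i : Fin n) :
    IdentDistrib (ys i) y P Q :=
  (hS.identDistrib i).comp measurable_snd

theorem IsIIDSample.iIndepFun_features (hS : IsIIDSample Q X y P Xs ys) : iIndepFun Xs P :=
  hS.indep.comp (fun _ => Prod.fst) fun _ => measurable_fst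

theorem IsIIDSample.iIndepFun_response (hS : IsIIDSample Q X y P Xs ys) : iIndepFun ys P :=
  hS.indep.comp (fun _ => Prod.snd) fun _ => measurable_snd

theorem IsIIDSample.aemeasurable_norm_sum_smul_sq (hS : IsIIDSample Q X y P Xs ys)
    (w : Fin n → ℝ) : AEMeasurable (fun ω => ‖∑ i, w i • Xs i ω‖ ^ 2) P := by
  have h (i : Fin n) : AEMeasurable (Xs i) P := (hS.identDistrib_features i).aemeasurable_fst
  fun_prop

theorem IsIIDSample.measureReal_mul_le_sum_sq_response_le (hS : IsIIDSample Q X y P Xs ys)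
    (hXy : SubGaussianPair Q M X y) (hM : 0 < M) (hy : 0 < ∫ ω, y ω ^ 2 ∂Q) :
    P.real {ω | 2 * M ^ 2 * (∫ ω', y ω' ^ 2 ∂Q) * n ≤ ∑ i, ys i ω ^ 2} ≤ Real.exp (-n) := by
  have hmoment (i : Fin n) :
      expMoment P (fun ω => ys i ω ^ 2 / (M * √(∫ ω', y ω' ^ 2 ∂Q)) ^ 2) ≤ 2 := by
    rw [expMoment_congr_identDistrib (hS.identDistrib_response i)
      (h := fun t => t ^ 2 / (M * √(∫ ω', y ω' ^ 2 ∂Q)) ^ 2) (by fun_prop)]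
    exact hXy.expMoment_response_le hM hy
  have h := measureReal_two_mul_sq_mul_card_le_sum_sq_le hS.iIndepFun_response
    (fun i => (hS.identDistrib_response i).aemeasurable_fst) (by positivity) hmoment
  rwa [mul_pow, Real.sq_sqrt hy.le, Fintype.card_fin, ← mul_assoc] at h

theorem IsIIDSample.expMoment_norm_sum_smul_sq_le (hS : IsIIDSample Q X y P Xs ys)
    (hXy : SubGaussianPair Q M X y) (hM : 0 < M) {s C k K c : ℝ} (hC : 0 ≤ C)
    (hs : 4 * |s| * C * mgfRadius M ≤ 1) (hK : k + 4 * C * mgfRadius M * |s * K| ≤ K)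
    (hMGF : ∀ U, IsStdSubGaussian Q M U → HasQuadraticMGFBound Q U s (mgfRadius M) k C)
    (hc : 0 ≤ c) (hcM : c * ‖toEuclideanCLM (𝕜 := ℝ) (covMatrix Q X)‖ ≤ mgfRadius M)
    {w : EuclideanSpace ℝ (Fin n)} (hw : ‖w‖ = 1) :
    expMoment P (fun ω => s * (c * ‖∑ i, w i • Xs i ω‖ ^ 2)) ≤
      ENNReal.ofReal (Real.exp (K * (c * (covMatrix Q X).trace))) := by
  have hXL := hXy.memLp_features hM
  have := hXy.isProbabilityMeasure
  obtain ⟨X', -, hX'i, hX', -, hX, -⟩ := hXy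
  set S := covMatrix Q X
  have hBB : (CFC.sqrt S)ᵀ * CFC.sqrt S = S := by
    rw [← conjTranspose_eq_transpose_of_trivial,
      (nonneg_iff_posSemidef.mp (CFC.sqrt_nonneg S)).isHermitian.eq,
      CFC.sqrt_mul_sqrt_self S (covMatrix_posSemidef hXL).nonneg]
  have hcS : c • ((CFC.sqrt S)ᵀ * CFC.sqrt S) ≤ mgfRadius M • 1 :=
    calc c • ((CFC.sqrt S)ᵀ * CFC.sqrt S)
        ≤ c • (‖toEuclideanCLM (𝕜 := ℝ) S‖ • 1) := by
          rw [hBB]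
          exact smul_le_smul_of_nonneg_left (le_opNorm_smul_one covMatrix_isHermitian) hc
      _ = (c * ‖toEuclideanCLM (𝕜 := ℝ) S‖) • 1 := smul_smul _ _ _
      _ ≤ mgfRadius M • 1 := smul_le_smul_of_nonneg_right hcM zero_le_one
  have hww : w.ofLp ⬝ᵥ w.ofLp = 1 := by
    have hsq := EuclideanSpace.real_norm_sq_eq w
    rw [hw, one_pow] at hsq
    simpa only [dotProduct, sq] using hsq.symm
  have key := NullRisk.expMoment_norm_sum_smul_sq_le hC (mgfRadius_pos hM).le hs hK hX'i
    (fun j => (hX' j).aemeasurable) (fun j => hMGF _ (hX' j)) hX hS.iIndepFun_features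
    hS.identDistrib_features hc hcS hww
  rwa [hBB] at key

variable (hS : IsIIDSample Q X y P Xs ys) (hXy : SubGaussianPair Q M X y) (hM : 0 < M)
  (hr : 0 < effectiveRank (covMatrix Q X))
include hS hXy hM hr

theorem IsIIDSample.measureReal_mul_trace_le_mul_norm_sum_smul_sq_le {s C k K : ℝ} (hC : 0 ≤ C)
    (hs : 4 * |s| * C * mgfRadius M ≤ 1) (hK : k + 4 * C * mgfRadius M * |s * K| ≤ K)
    (hMGF : ∀ U, IsStdSubGaussian Q M U → HasQuadraticMGFBound Q U s (mgfRadius M) k C)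
    {w : EuclideanSpace ℝ (Fin n)} (hw : ‖w‖ = 1) (τ : ℝ) :
    P.real {ω | s * (τ * (covMatrix Q X).trace) ≤ s * ‖∑ i, w i • Xs i ω‖ ^ 2} ≤
      Real.exp ((K - s * τ) * (mgfRadius M * effectiveRank (covMatrix Q X))) := by
  have hN := opNorm_pos_of_effectiveRank_pos hr
  set c := mgfRadius M / ‖toEuclideanCLM (𝕜 := ℝ) (covMatrix Q X)‖ with hc_def
  have hc : 0 < c := div_pos (mgfRadius_pos hM) hN
  have markov := measureReal_le_of_expMoment_le
    (((hS.aemeasurable_norm_sum_smul_sq w).const_mul c).const_mul s)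
    (hS.expMoment_norm_sum_smul_sq_le hXy hM hC hs hK hMGF hc.le
      (div_mul_cancel₀ _ hN.ne').le hw)
    (s * (c * (τ * (covMatrix Q X).trace)))
  simp only [mul_left_comm s c, mul_le_mul_iff_right₀ hc] at markov
  refine markov.trans_eq (congrArg Real.exp ?_)
  rw [hc_def, effectiveRank]
  ring

theorem IsIIDSample.measureReal_mul_trace_le_norm_sum_smul_sq_le {w : EuclideanSpace ℝ (Fin n)}
    (hw : ‖w‖ = 1) :
    P.real {ω | (2 * M ^ 2 + 1) * (covMatrix Q X).trace ≤ ‖∑ i, w i • Xs i ω‖ ^ 2} ≤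
      Real.exp (-(mgfRadius M * effectiveRank (covMatrix Q X))) := by
  have := hXy.isProbabilityMeasure
  have := mgfRadius_pos hM
  have hη2 := mgfRadius_mul_sq_le hM
  have h := hS.measureReal_mul_trace_le_mul_norm_sum_smul_sq_le hXy hM hr (s := 1)
    (C := 2 * M ^ 2) (k := M ^ 2) (K := 2 * M ^ 2) (by positivity) (by rw [abs_one]; linarith)
    (by rw [one_mul, abs_of_nonneg (by positivity)]; nlinarith [sq_nonneg M])
    (fun U hU => hasQuadraticMGFBound_one hU.aemeasurable hM (hU.expMoment_sq_div_sq_le_two hM)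
      hU.mean_eq_zero (by linarith)) hw (2 * M ^ 2 + 1)
  simp only [one_mul] at h
  exact h.trans_eq (congrArg Real.exp (by ring))

theorem IsIIDSample.measureReal_norm_sum_smul_sq_le_trace_div_four_le
    {w : EuclideanSpace ℝ (Fin n)} (hw : ‖w‖ = 1) :
    P.real {ω | ‖∑ i, w i • Xs i ω‖ ^ 2 ≤ (covMatrix Q X).trace / 4} ≤
      Real.exp (-(mgfRadius M * effectiveRank (covMatrix Q X) / 4)) := by
  have := hXy.isProbabilityMeasure
  have := mgfRadius_pos hM
  have hη2 := mgfRadius_mul_sq_le hM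
  have hη4 := mgfRadius_mul_pow_four_le hM
  have h := hS.measureReal_mul_trace_le_mul_norm_sum_smul_sq_le hXy hM hr (s := -1)
    (C := 2 * M ^ 2) (k := -(3 / 4)) (K := -(1 / 2)) (by positivity)
    (by rw [abs_neg, abs_one]; linarith) (by norm_num; linarith)
    (fun U hU => hasQuadraticMGFBound_neg_one hU.aemeasurable hM
      (hU.expMoment_sq_div_sq_le_two hM) hU.mean_eq_zero hU.integral_sq_eq_one (by linarith))
    hw (1 / 4)
  simp only [neg_one_mul, neg_le_neg_iff, one_div_mul_eq_div] at h
  exact h.trans_eq (congrArg Real.exp (by ring))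

end Sample

/-! ### The finite-sample bound -/

section Constants

open scoped NNReal

/-- The mesh of the net of the unit sphere on which the smallest singular value of the data matrix
is estimated, fine enough for the upper bound `(2 * M ^ 2 + 1) * tr` to be absorbed by the lower
bound `tr / 4`. -/
noncomputable def netRadius (M : ℝ) : ℝ≥0 :=
  (1 / (8 * √(2 * M ^ 2 + 1))).toNNReal

/-- The ratio of effective rank to sample size beyond which the deviation probabilities survive
the union bound over a net of radius `netRadius M`. -/
noncomputable def rankThreshold (M : ℝ) : ℝ :=
  1 + 4 * (1 + Real.log (1 + 2 / netRadius M)) / mgfRadius M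

variable {M : ℝ}

theorem coe_netRadius : (netRadius M : ℝ) = 1 / (8 * √(2 * M ^ 2 + 1)) :=
  Real.coe_toNNReal _ (by positivity)

theorem netRadius_pos : 0 < netRadius M :=
  Real.toNNReal_pos.mpr (by positivity)

theorem eight_mul_netRadius_mul_sqrt : 8 * netRadius M * √(2 * M ^ 2 + 1) = 1 := by
  have : 0 < √(2 * M ^ 2 + 1) := by positivity
  rw [coe_netRadius]
  field_simp

theorem log_one_add_two_div_netRadius_nonneg : 0 ≤ Real.log (1 + 2 / netRadius M) :=
  Real.log_nonneg (le_add_of_nonneg_right (by positivity))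

theorem one_lt_rankThreshold (hM : 0 < M) : 1 < rankThreshold M := by
  have := mgfRadius_pos hM
  have := log_one_add_two_div_netRadius_nonneg (M := M)
  exact lt_add_of_pos_right 1 (by positivity)

theorem pow_mul_exp_neg_le_exp_neg (hM : 0 < M) {n : ℕ} {r : ℝ} (h : rankThreshold M * n ≤ r) :
    (1 + 2 / netRadius M) ^ n * Real.exp (-(mgfRadius M * r / 4)) ≤ Real.exp (-n) := by
  have hη := mgfRadius_pos hM
  have hexponent : n * (1 + Real.log (1 + 2 / netRadius M)) ≤ mgfRadius M * r / 4 :=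
    calc n * (1 + Real.log (1 + 2 / netRadius M))
        ≤ n * (1 + Real.log (1 + 2 / netRadius M)) + mgfRadius M * n / 4 :=
          le_add_of_nonneg_right (by positivity)
      _ = mgfRadius M * (rankThreshold M * n) / 4 := by
          unfold rankThreshold
          field_simp
          ring
      _ ≤ mgfRadius M * r / 4 := by gcongr
  calc (1 + 2 / netRadius M) ^ n * Real.exp (-(mgfRadius M * r / 4))
      = Real.exp (n * Real.log (1 + 2 / netRadius M) - mgfRadius M * r / 4) := by
        rw [sub_eq_add_neg, Real.exp_add, Real.exp_nat_mul, Real.exp_log (by positivity)]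
    _ ≤ Real.exp (-n) := Real.exp_le_exp.mpr (by linarith)

end Constants

theorem sqrt_div_four_mul_norm_le_norm_sum_smul {ι F : Type*} [Fintype ι] [NormedAddCommGroup F]
    [NormedSpace ℝ F] (v : ι → F) {s : Set (EuclideanSpace ℝ ι)} {t M : ℝ}
    (hs : Metric.IsCover (netRadius M) (Metric.sphere 0 1) s)
    (hup : ∀ c ∈ s, ‖∑ i, c i • v i‖ ^ 2 ≤ (2 * M ^ 2 + 1) * t)
    (hlow : ∀ c ∈ s, t / 4 ≤ ‖∑ i, c i • v i‖ ^ 2) (x : EuclideanSpace ℝ ι) :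
    √t / 4 * ‖x‖ ≤ ‖∑ i, x i • v i‖ := by
  let L : EuclideanSpace ℝ ι →L[ℝ] F := ∑ i, (EuclideanSpace.proj i).smulRight (v i)
  have hL (x : EuclideanSpace ℝ ι) : L x = ∑ i, x i • v i := by simp [L]
  have hlow' : ∀ c ∈ s, √t / 2 ≤ ‖L c‖ := fun c hc => by
    have h := Real.sqrt_le_sqrt (hlow c hc)
    rwa [Real.sqrt_div' t zero_le_four, Real.sqrt_sq (norm_nonneg _), ← hL,
      show √(4 : ℝ) = 2 by rw [Real.sqrt_eq_iff_mul_self_eq] <;> norm_num] at h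
  have hup' : ∀ c ∈ s, ‖L c‖ ≤ √(2 * M ^ 2 + 1) * √t := fun c hc => by
    rw [← Real.sqrt_mul (by positivity), hL]
    exact Real.le_sqrt_of_sq_le (hup c hc)
  have hε := eight_mul_netRadius_mul_sqrt (M := M)
  have hκ : 1 ≤ √(2 * M ^ 2 + 1) := Real.one_le_sqrt.mpr (by linarith [sq_nonneg M])
  have hopNorm := one_sub_mul_opNorm_le_of_isCover_sphere L hs (by positivity) hup'
  have hmesh : netRadius M * ‖L‖ ≤ √t / 4 := by
    have : (netRadius M : ℝ) ≤ 1 / 8 := by nlinarith [(netRadius M).coe_nonneg]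
    have : netRadius M * ((1 - netRadius M) * ‖L‖) ≤ √t / 8 :=
      calc _ ≤ netRadius M * (√(2 * M ^ 2 + 1) * √t) := by gcongr
        _ = √t / 8 := by linear_combination √t / 8 * hε
    nlinarith [mul_nonneg (netRadius M).coe_nonneg (norm_nonneg L), Real.sqrt_nonneg t]
  calc √t / 4 * ‖x‖ ≤ (√t / 2 - netRadius M * ‖L‖) * ‖x‖ := by gcongr; linarith
    _ ≤ ‖L x‖ := sub_mul_norm_le_of_isCover_sphere L hs hlow' x
    _ = _ := by rw [hL]

section FiniteSample

open Matrix

variable {Ω₀ Ω : Type*} [MeasurableSpace Ω₀] {n p : ℕ} {Q : Measure Ω₀}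
  {X : Ω₀ → EuclideanSpace ℝ (Fin p)} {y : Ω₀ → ℝ}
  {Xs : Fin n → Ω → EuclideanSpace ℝ (Fin p)} {ys : Fin n → Ω → ℝ} {M : ℝ}

theorem abs_risk_sampleEstimator_div_risk_zero_sub_one_le (hXy : SubGaussianPair Q M X y)
    (hM : 0 < M) (hy : 0 < ∫ ω, y ω ^ 2 ∂Q) (hn : 0 < n) (hr : n ≤ effectiveRank (covMatrix Q X))
    {ω : Ω} (hX : ∀ x : EuclideanSpace ℝ (Fin n),
      √(covMatrix Q X).trace / 4 * ‖x‖ ≤ ‖∑ i, x i • Xs i ω‖)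
    (hys : ∑ i, ys i ω ^ 2 ≤ 2 * M ^ 2 * (∫ ω', y ω' ^ 2 ∂Q) * n) :
    |risk Q X y (sampleEstimator Xs ys ω) / risk Q X y 0 - 1| ≤
      (36 * M ^ 2 + 12 * M) * √(n / effectiveRank (covMatrix Q X)) := by
  have := hXy.isProbabilityMeasure
  set r := effectiveRank (covMatrix Q X) with hr_def
  set α := sampleEstimator Xs ys ω
  have hr0 : 0 < r := (Nat.cast_pos.mpr hn).trans_le hr
  have htr := trace_pos_of_effectiveRank_pos hr0
  have hratio : √(n / r) ^ 2 = n / r := Real.sq_sqrt (by positivity)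
  have hα : (covMatrix Q X).trace * ‖α‖ ^ 2 ≤ 32 * M ^ 2 * (∫ ω', y ω' ^ 2 ∂Q) * n := by
    have h := pow_le_pow_left₀ (by positivity) (mul_norm_sampleEstimator_le (ys := ys)
      (by positivity) hX) 2
    rw [mul_pow, div_pow, Real.sq_sqrt htr.le,
      EuclideanSpace.real_norm_sq_eq (WithLp.toLp 2 fun i => ys i ω)] at h
    linarith
  have hopNorm : ‖toEuclideanCLM (𝕜 := ℝ) (covMatrix Q X)‖ = (covMatrix Q X).trace / r := by
    rw [hr_def, effectiveRank, div_div_cancel₀ htr.ne']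
  have hshort : ‖toEuclideanCLM (𝕜 := ℝ) (covMatrix Q X)‖ * ‖α‖ ^ 2 ≤
      (6 * M * √(n / r)) ^ 2 * ∫ ω', y ω' ^ 2 ∂Q :=
    calc _ = (covMatrix Q X).trace * ‖α‖ ^ 2 / r := by rw [hopNorm, div_mul_eq_mul_div]
      _ ≤ 32 * M ^ 2 * (∫ ω', y ω' ^ 2 ∂Q) * n / r := div_le_div_of_nonneg_right hα hr0.le
      _ ≤ 36 * M ^ 2 * (∫ ω', y ω' ^ 2 ∂Q) * n / r := by gcongr; norm_num
      _ = _ := by rw [mul_pow, hratio]; ring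
  have hsqrt : √(n / r) ^ 2 ≤ √(n / r) :=
    pow_le_of_le_one (Real.sqrt_nonneg _)
      (Real.sqrt_le_one.mpr ((div_le_one hr0).mpr hr)) two_ne_zero
  calc |risk Q X y α / risk Q X y 0 - 1|
      ≤ (6 * M * √(n / r)) ^ 2 + 2 * (6 * M * √(n / r)) :=
        abs_risk_div_risk_zero_sub_one_le (hXy.memLp_features hM)
          (hXy.integral_features_eq_zero hM) (hXy.memLp_response hM) hy (by positivity) hshort
    _ = 36 * M ^ 2 * √(n / r) ^ 2 + 12 * M * √(n / r) := by ring
    _ ≤ 36 * M ^ 2 * √(n / r) + 12 * M * √(n / r) := by gcongr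
    _ = (36 * M ^ 2 + 12 * M) * √(n / r) := by ring

variable [MeasurableSpace Ω] {P : Measure Ω}

theorem IsIIDSample.measureReal_exists_mem_net_le (hS : IsIIDSample Q X y P Xs ys)
    (hXy : SubGaussianPair Q M X y) (hM : 0 < M) (hr : 0 < effectiveRank (covMatrix Q X))
    {s : Finset (EuclideanSpace ℝ (Fin n))} (hs : ∀ c ∈ s, ‖c‖ = 1) :
    P.real {ω | ∃ c ∈ s, (2 * M ^ 2 + 1) * (covMatrix Q X).trace ≤ ‖∑ i, c i • Xs i ω‖ ^ 2 ∨
      ‖∑ i, c i • Xs i ω‖ ^ 2 ≤ (covMatrix Q X).trace / 4} ≤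
      s.card * (2 * Real.exp (-(mgfRadius M * effectiveRank (covMatrix Q X) / 4))) := by
  have hη := mgfRadius_pos hM
  have hunion : {ω | ∃ c ∈ s, (2 * M ^ 2 + 1) * (covMatrix Q X).trace ≤ ‖∑ i, c i • Xs i ω‖ ^ 2 ∨
      ‖∑ i, c i • Xs i ω‖ ^ 2 ≤ (covMatrix Q X).trace / 4} =
      ⋃ c ∈ s, ({ω | (2 * M ^ 2 + 1) * (covMatrix Q X).trace ≤ ‖∑ i, c i • Xs i ω‖ ^ 2} ∪
        {ω | ‖∑ i, c i • Xs i ω‖ ^ 2 ≤ (covMatrix Q X).trace / 4}) := by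
    ext ω
    simp
  rw [hunion, ← nsmul_eq_mul]
  refine (measureReal_biUnion_finset_le _ _).trans (Finset.sum_le_card_nsmul _ _ _ fun c hc => ?_)
  rw [two_mul (Real.exp _)]
  refine (measureReal_union_le _ _).trans (add_le_add ?_ ?_)
  · refine (hS.measureReal_mul_trace_le_norm_sum_smul_sq_le hXy hM hr (hs c hc)).trans ?_
    exact Real.exp_le_exp.mpr (neg_le_neg (div_le_self (by positivity) (by norm_num)))
  · exact hS.measureReal_norm_sum_smul_sq_le_trace_div_four_le hXy hM hr (hs c hc)

theorem IsIIDSample.one_sub_le_measureReal_abs_risk_div_sub_one_le [IsProbabilityMeasure P]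
    (hS : IsIIDSample Q X y P Xs ys) (hXy : SubGaussianPair Q M X y) (hM : 0 < M)
    (hy : 0 < ∫ ω, y ω ^ 2 ∂Q) (hr : rankThreshold M * n ≤ effectiveRank (covMatrix Q X)) :
    1 - 3 * Real.exp (-n) ≤
      P.real {ω | |risk Q X y (sampleEstimator Xs ys ω) / risk Q X y 0 - 1| ≤
        (36 * M ^ 2 + 12 * M) * √(n / effectiveRank (covMatrix Q X))} := by
  rcases n.eq_zero_or_pos with hn | hn
  · refine le_trans ?_ measureReal_nonneg
    norm_num [hn]
  have hnr : n ≤ effectiveRank (covMatrix Q X) :=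
    (le_mul_of_one_le_left n.cast_nonneg (one_lt_rankThreshold hM).le).trans hr
  have hr0 : 0 < effectiveRank (covMatrix Q X) := (Nat.cast_pos.mpr hn).trans_le hnr
  obtain ⟨s, hs_norm, hs_cover, hs_card⟩ :=
    exists_finset_isCover_sphere (E := EuclideanSpace ℝ (Fin n)) (netRadius_pos (M := M))
  rw [finrank_euclideanSpace_fin] at hs_card
  set G := {ω | |risk Q X y (sampleEstimator Xs ys ω) / risk Q X y 0 - 1| ≤
    (36 * M ^ 2 + 12 * M) * √(n / effectiveRank (covMatrix Q X))}
  set D := {ω | ∃ c ∈ s, (2 * M ^ 2 + 1) * (covMatrix Q X).trace ≤ ‖∑ i, c i • Xs i ω‖ ^ 2 ∨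
    ‖∑ i, c i • Xs i ω‖ ^ 2 ≤ (covMatrix Q X).trace / 4} with hD_def
  set Y := {ω | 2 * M ^ 2 * (∫ ω', y ω' ^ 2 ∂Q) * n ≤ ∑ i, ys i ω ^ 2} with hY_def
  have hD : P.real D ≤ 2 * Real.exp (-n) :=
    calc P.real D ≤ s.card * (2 * Real.exp (-(mgfRadius M * effectiveRank (covMatrix Q X) / 4))) :=
          hS.measureReal_exists_mem_net_le hXy hM hr0 hs_norm
      _ ≤ (1 + 2 / netRadius M) ^ n *
          (2 * Real.exp (-(mgfRadius M * effectiveRank (covMatrix Q X) / 4))) := by gcongr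
      _ ≤ 2 * Real.exp (-n) := by linarith [pow_mul_exp_neg_le_exp_neg hM hr]
  have hY : P.real Y ≤ Real.exp (-n) := hS.measureReal_mul_le_sum_sq_response_le hXy hM hy
  have hcover : Set.univ ⊆ G ∪ (D ∪ Y) := fun ω _ => by
    by_contra! hω
    simp only [Set.mem_union, not_or, hD_def, hY_def, Set.mem_ofPred_eq, not_exists, not_and,
      not_le] at hω
    obtain ⟨hG, hnet, hys⟩ := hω
    exact hG (abs_risk_sampleEstimator_div_risk_zero_sub_one_le hXy hM hy hn hnr
      (sqrt_div_four_mul_norm_le_norm_sum_smul (fun i => Xs i ω) hs_cover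
        (fun c hc => (hnet c hc).1.le) fun c hc => (hnet c hc).2.le) hys.le)
  have : 1 ≤ P.real G + (P.real D + P.real Y) :=
    calc 1 = P.real Set.univ := probReal_univ.symm
      _ ≤ P.real (G ∪ (D ∪ Y)) := measureReal_mono hcover
      _ ≤ P.real G + P.real (D ∪ Y) := measureReal_union_le _ _
      _ ≤ P.real G + (P.real D + P.real Y) := by gcongr; exact measureReal_union_le _ _
  linarith

end FiniteSample

section InProbability

variable {ι : Type*} {l : Filter ι}

theorem tendsto_sqrt_div_zero {a b : ι → ℝ} (h : Tendsto (fun k => b k / a k) l atTop) :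
    Tendsto (fun k => √(a k / b k)) l (𝓝 0) := by
  simpa using h.inv_tendsto_atTop.sqrt

theorem tendsto_one_sub_mul_exp_neg {n : ι → ℕ} (hn : Tendsto n l atTop) (c : ℝ) :
    Tendsto (fun k => 1 - c * Real.exp (-n k)) l (𝓝 1) := by
  have hexp : Tendsto (fun k => Real.exp (-n k)) l (𝓝 0) :=
    Real.tendsto_exp_neg_atTop_nhds_zero.comp (tendsto_natCast_atTop_atTop.comp hn)
  simpa using (hexp.const_mul c).const_sub 1

theorem tendsto_measureReal_lt_of_le {Ω : ι → Type*} [∀ k, MeasurableSpace (Ω k)]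
    {P : ∀ k, Measure (Ω k)} [∀ k, IsProbabilityMeasure (P k)] {Z : ∀ k, Ω k → ℝ} {δ q : ι → ℝ}
    (hδ : Tendsto δ l (𝓝 0)) (hq : Tendsto q l (𝓝 1))
    (h : ∀ᶠ k in l, q k ≤ (P k).real {ω | Z k ω ≤ δ k}) {ε : ℝ} (hε : 0 < ε) :
    Tendsto (fun k => (P k).real {ω | Z k ω < ε}) l (𝓝 1) := by
  refine tendsto_of_tendsto_of_tendsto_of_le_of_le' hq tendsto_const_nhds ?_
    (.of_forall fun k => measureReal_le_one)
  filter_upwards [h, hδ.eventually_lt_const hε] with k hk hδk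
  exact hk.trans (measureReal_mono fun ω (hω : Z k ω ≤ δ k) => hω.trans_lt hδk)

end InProbability

end NullRisk

theorem mainTheorem2 (M : ℝ) (hM : 0 < M) :
    -- the finite-sample bound; the constants depend only on the bound `M` on the ψ₂-norms
    (∃ C c c' K : ℝ, 1 < C ∧ 0 < c ∧ 0 < c' ∧ 0 < K ∧
      ∀ (n p : ℕ) (Ω₀ : Type u) (Ω : Type v) [MeasurableSpace Ω₀] [MeasurableSpace Ω]
        (Q : Measure Ω₀) (P : Measure Ω) [IsProbabilityMeasure Q] [IsProbabilityMeasure P]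
        (X : Ω₀ → EuclideanSpace ℝ (Fin p)) (y : Ω₀ → ℝ)
        (Xs : Fin n → Ω → EuclideanSpace ℝ (Fin p)) (ys : Fin n → Ω → ℝ),
        NullRisk.SubGaussianPair Q M X y →
        0 < ∫ ω, y ω ^ 2 ∂Q →
        NullRisk.IsIIDSample Q X y P Xs ys →
        C * n < NullRisk.effectiveRank (NullRisk.covMatrix Q X) →
        1 - c * Real.exp (-(c' * n)) ≤
          P.real {ω | |NullRisk.risk Q X y (NullRisk.sampleEstimator Xs ys ω) /
              NullRisk.risk Q X y 0 - 1| ≤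
            K * √(n / NullRisk.effectiveRank (NullRisk.covMatrix Q X))}) ∧
    -- the asymptotic consequence: the risk ratio tends to one in probability along every sequence
    -- of such problems with `n → ∞` and effective rank of larger order than `n`
    (∀ (n p : ℕ → ℕ) (Ω₀ : ℕ → Type u) (Ω : ℕ → Type v)
        [∀ k, MeasurableSpace (Ω₀ k)] [∀ k, MeasurableSpace (Ω k)]
        (Q : ∀ k, Measure (Ω₀ k)) (P : ∀ k, Measure (Ω k))
        [∀ k, IsProbabilityMeasure (Q k)] [∀ k, IsProbabilityMeasure (P k)]
        (X : ∀ k, Ω₀ k → EuclideanSpace ℝ (Fin (p k))) (y : ∀ k, Ω₀ k → ℝ)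
        (Xs : ∀ k, Fin (n k) → Ω k → EuclideanSpace ℝ (Fin (p k)))
        (ys : ∀ k, Fin (n k) → Ω k → ℝ),
        (∀ k, NullRisk.SubGaussianPair (Q k) M (X k) (y k)) →
        (∀ k, 0 < ∫ ω, y k ω ^ 2 ∂(Q k)) →
        (∀ k, NullRisk.IsIIDSample (Q k) (X k) (y k) (P k) (Xs k) (ys k)) →
        Tendsto n atTop atTop →
        Tendsto (fun k => NullRisk.effectiveRank (NullRisk.covMatrix (Q k) (X k)) / (n k : ℝ))
          atTop atTop →
        ∀ ε : ℝ, 0 < ε →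
          Tendsto (fun k => (P k).real {ω |
              |NullRisk.risk (Q k) (X k) (y k) (NullRisk.sampleEstimator (Xs k) (ys k) ω) /
                NullRisk.risk (Q k) (X k) (y k) 0 - 1| < ε})
            atTop (𝓝 1)) := by
  refine ⟨⟨NullRisk.rankThreshold M, 3, 1, 36 * M ^ 2 + 12 * M, NullRisk.one_lt_rankThreshold hM,
    by norm_num, one_pos, by positivity, ?_⟩, ?_⟩
  · intro n p Ω₀ Ω _ _ Q P _ _ X y Xs ys hXy hy hS hr
    rw [one_mul]
    exact hS.one_sub_le_measureReal_abs_risk_div_sub_one_le hXy hM hy hr.le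
  · intro n p Ω₀ Ω _ _ Q P _ _ X y Xs ys hXy hy hS hn hr ε hε
    have hrank : ∀ᶠ k in atTop, NullRisk.rankThreshold M * n k ≤
        NullRisk.effectiveRank (NullRisk.covMatrix (Q k) (X k)) := by
      filter_upwards [hr.eventually_ge_atTop (NullRisk.rankThreshold M),
        hn.eventually_gt_atTop 0] with k hrk hnk
      exact (le_div_iff₀ (Nat.cast_pos.mpr hnk)).mp hrk
    have hbound : Tendsto (fun k => (36 * M ^ 2 + 12 * M) * √(n k /
        NullRisk.effectiveRank (NullRisk.covMatrix (Q k) (X k)))) atTop (𝓝 0) := by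
      simpa only [mul_zero] using (NullRisk.tendsto_sqrt_div_zero hr).const_mul _
    exact NullRisk.tendsto_measureReal_lt_of_le hbound
      (NullRisk.tendsto_one_sub_mul_exp_neg hn 3)
      (hrank.mono fun k => (hS k).one_sub_le_measureReal_abs_risk_div_sub_one_le (hXy k) hM (hy k))
      hε
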